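/- Let $(M,g)$ be a (smooth, finite-dimensional) Riemannian manifold with Levi-Civita connection $\nabla$, let $(N,J,h)$ be a Kähler manifold (a complex manifold with a Hermitian metric $h$ whose fundamental 2-form is closed), and let $\varphi:(M,g)\to(N,J,h)$ be a non-constant smooth map satisfying $$[d\varphi\circ(d\varphi)^{*},J]=0, \tag{PHWC}$$ where $(d\varphi_p)^*:T_{\varphi(p)}N\to T_pM$ is the adjoint of $d\varphi_p$ with respect to $g$ and $h$. For $p\in M$ let $F=F^{\varphi}_p$ be the unique skew-symmetric endomorphism of $(T_pM,g_p)$ with $F^3+F=0$ whose space of complex covectors $T^{*+}_pM=\{\theta:\theta\circ F=i\theta\}$ equals $\{\eta\circ d\varphi_p:\eta\in T^{(1,0)*}_{\varphi(p)}N\}$ (it exists and is unique because of (PHWC)). Put $T^{+}M,T^{-}M,T^{0}M\subseteq T^{\mathbb C}M$ for the eigenspaces of $F$ for the eigenvalues $i,-i,0$ and $T^{*-}M=\{\theta:\theta\circ F=-i\theta\}$; a vector in one of the spaces $T^{+}M,T^{-}M,T^{0}M$ is said to be of the corresponding type. Suppose that: 1. $F$ is integrable: around every point of $M$ there are smooth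 coordinates $(x^1,\dots,x^k,y^1,\dots,y^k,z^1,\dots,z^l)$ in which $F\,\partial_{x^i}=\partial_{y^i}$, $F\,\partial_{y^i}=-\partial_{x^i}$ and $F\,\partial_{z^j}=0$; 2. $\nabla_{T^0M}(T^{*+}M)\subseteq T^{*+}M+T^{*-}M$, that is, $\nabla_v\theta\in T^{*+}_pM+T^{*-}_pM$ for every $p\in M$, every $v\in T^0_pM$ and every smooth section $\theta$ of $T^{*+}M$ on an open neighbourhood of $p$; 3. the fundamental 2-form $\omega(X,Y)=g(X,FY)$, extended complex-linearly, satisfies $d\omega^{(1,2)}=0$, that is, $d\omega(u,v,w)=0$ whenever $u,v$ are of the same type and $w$ is of a different type. Then $\varphi$ is harmonic, that is, its tension field $\tau(\varphi)=\operatorname{trace}_g\nabla d\varphi$ vanishes. -/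

import Mathlib

open Bundle Set
open scoped Manifold ContDiff Topology

noncomputable section

namespace PHM

/-! ### Coordinate calculus for a metric `G` on an open subset of a vector space -/

section Coordinates

variable {E : Type*} [NormedAddCommGroup E] [NormedSpace ℝ E]

/-- The Christoffel symbols `Γ(v, ·)` at `u` of the Levi-Civita connection of `G`:
`G(Γ(v, w), z) = ½ (∂_v G(w, z) + ∂_w G(v, z) - ∂_z G(v, w))`.
Here `(G u).inverse` is the isomorphism from covectors to vectors (raising an index). -/
def christoffel (G : E → E →L[ℝ] E →L[ℝ] ℝ) (u v : E) : E →L[ℝ] E :=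
  (G u).inverse ∘L ((1 / 2 : ℝ) •
    (fderiv ℝ G u v + (fderiv ℝ G u).flip v - ((fderiv ℝ G u).flip v).flip))

/-- The metric trace `∑ g^{ij} B(b_i, b_j)` with respect to the inner product `G`. -/
def metricTrace [FiniteDimensional ℝ E] {W : Type*} [AddCommMonoid W]
    (G : E →L[ℝ] E →L[ℝ] ℝ) (B : E → E → W) : W :=
  ∑ i, B (Module.finBasis ℝ E i)
    (G.inverse (LinearMap.toContinuousLinearMap ((Module.finBasis ℝ E).coord i)))

/-- The exterior derivative of a 2-form on an open subset of a vector space. -/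
def coordExtDeriv (β : E → E →L[ℝ] E →L[ℝ] ℝ) (a u v w : E) : ℝ :=
  fderiv ℝ β a u v w - fderiv ℝ β a v u w + fderiv ℝ β a w u v

end Coordinates

/-! ### Tensors on a manifold, read in the preferred chart at a point

The tangent space at `p` is, by definition in Mathlib, the model space `E`, a tangent vector being
identified with its coordinates in the preferred chart at `p`. So the value at `p` of an expression
computed in that chart may be applied directly to tangent vectors at `p`. -/

section Manifold

variable {E : Type*} [NormedAddCommGroup E] [NormedSpace ℝ E]
  {M : Type*} [TopologicalSpace M] [ChartedSpace E M]

/-- The differential at `u` of the local parametrization inverse to the chart at `p`. -/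
def dParam (p : M) (u : E) : E →L[ℝ] TangentSpace 𝓘(ℝ, E) ((extChartAt 𝓘(ℝ, E) p).symm u) :=
  mfderiv 𝓘(ℝ, E) 𝓘(ℝ, E) (extChartAt 𝓘(ℝ, E) p).symm u

/-- Coordinate expression, in the chart at `p`, of a field of bilinear forms. -/
def bilinInChart (p : M)
    (B : Π x : M, TangentSpace 𝓘(ℝ, E) x →L[ℝ] TangentSpace 𝓘(ℝ, E) x →L[ℝ] ℝ) (u : E) :
    E →L[ℝ] E →L[ℝ] ℝ :=
  (ContinuousLinearMap.precomp ℝ (dParam p u)) ∘L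
    (B ((extChartAt 𝓘(ℝ, E) p).symm u) ∘L dParam p u)

/-- Coordinate expression, in the chart at `p`, of a complex 1-form. -/
def covectorInChart (p : M) (θ : Π x : M, TangentSpace 𝓘(ℝ, E) x →L[ℝ] ℂ) (u : E) : E →L[ℝ] ℂ :=
  θ ((extChartAt 𝓘(ℝ, E) p).symm u) ∘L dParam p u

/-- The exterior derivative at `p` of a 2-form on a manifold. -/
def extDerivTwo (β : Π x : M, TangentSpace 𝓘(ℝ, E) x →L[ℝ] TangentSpace 𝓘(ℝ, E) x →L[ℝ] ℝ)
    (p : M) (u v w : TangentSpace 𝓘(ℝ, E) p) : ℝ :=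
  coordExtDeriv (bilinInChart p β) (extChartAt 𝓘(ℝ, E) p p) u v w

/-- The Levi-Civita covariant derivative `∇_v θ` at `p` of a complex 1-form. -/
def covDerivForm [IsManifold 𝓘(ℝ, E) ∞ M]
    (g : ContMDiffRiemannianMetric 𝓘(ℝ, E) ∞ E (fun x : M => TangentSpace 𝓘(ℝ, E) x))
    (θ : Π x : M, TangentSpace 𝓘(ℝ, E) x →L[ℝ] ℂ) (p : M) (v : TangentSpace 𝓘(ℝ, E) p) :
    TangentSpace 𝓘(ℝ, E) p →L[ℝ] ℂ :=
  let u₀ : E := extChartAt 𝓘(ℝ, E) p p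
  let D : E →L[ℝ] ℂ := fderiv ℝ (covectorInChart p θ) u₀ v -
    covectorInChart p θ u₀ ∘L christoffel (bilinInChart p g.inner) u₀ v
  D

/-! ### f-structures -/

/-- A tangent vector of the complexified tangent space: the pair `u` stands for `u 0 + i u 1`. -/
abbrev CTangent (x : M) : Type _ := Fin 2 → TangentSpace 𝓘(ℝ, E) x

/-- The complex tangent vector `u` is in the eigenspace of `A` for the eigenvalue `s i`,
that is, `A (u 0) + i A (u 1) = s i (u 0 + i u 1)`. -/
def IsOfType {x : M} (A : TangentSpace 𝓘(ℝ, E) x →L[ℝ] TangentSpace 𝓘(ℝ, E) x) (s : ℝ)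
    (u : CTangent (E := E) x) : Prop :=
  A (u 0) = -(s • u 1) ∧ A (u 1) = s • u 0

/-- The space of complex covectors `θ` with `θ ∘ A = s i θ`. For `s = 1, -1, 0` these are the
covectors of type `+`, `-`, `0`. -/
def cotangentType {x : M} (A : TangentSpace 𝓘(ℝ, E) x →L[ℝ] TangentSpace 𝓘(ℝ, E) x) (s : ℝ) :
    Submodule ℂ (TangentSpace 𝓘(ℝ, E) x →L[ℝ] ℂ) where
  carrier := {θ | ∀ v, θ (A v) = ((s : ℂ) * Complex.I) * θ v}
  add_mem' := by
    intro a b ha hb v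
    simp only [mem_ofPred_eq] at ha hb
    simp [ha v, hb v, mul_add]
  zero_mem' := by intro v; simp
  smul_mem' := by
    intro c a ha v
    simp only [mem_ofPred_eq] at ha
    simp only [smul_apply, ha v, smul_eq_mul]
    ring

/-- `A` is integrable: around every point there are smooth coordinates
`(x¹, …, xᵏ, y¹, …, yᵏ, z¹, …, zˡ)` in which `A` has constant components, namely
`A ∂/∂xⁱ = ∂/∂yⁱ`, `A ∂/∂yⁱ = -∂/∂xⁱ`, `A ∂/∂zʲ = 0`. -/
def IsIntegrable (A : Π x : M, TangentSpace 𝓘(ℝ, E) x →L[ℝ] TangentSpace 𝓘(ℝ, E) x) : Prop :=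
  ∀ p : M, ∃ c ∈ IsManifold.maximalAtlas 𝓘(ℝ, E) ∞ M, p ∈ c.source ∧
    ∃ (k l : ℕ) (b : Module.Basis (Fin k ⊕ Fin k ⊕ Fin l) ℝ E), ∀ u ∈ c.target,
      let d : E →L[ℝ] TangentSpace 𝓘(ℝ, E) (c.symm u) := mfderiv 𝓘(ℝ, E) 𝓘(ℝ, E) c.symm u
      (∀ i, A (c.symm u) (d (b (.inl i))) = d (b (.inr (.inl i)))) ∧
      (∀ i, A (c.symm u) (d (b (.inr (.inl i)))) = -d (b (.inl i))) ∧
      (∀ j, A (c.symm u) (d (b (.inr (.inr j)))) = 0)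

/-- `∇_{T⁰M} (T*⁺M) ⊆ T*⁺M + T*⁻M`: for every smooth local section `θ` of `T*⁺M` and every
`v ∈ T⁰M`, the covariant derivative `∇_v θ` (complex linear in `v`) is in `T*⁺M + T*⁻M`. -/
def CovDerivZeroPlusCondition [IsManifold 𝓘(ℝ, E) ∞ M]
    (g : ContMDiffRiemannianMetric 𝓘(ℝ, E) ∞ E (fun x : M => TangentSpace 𝓘(ℝ, E) x))
    (A : Π x : M, TangentSpace 𝓘(ℝ, E) x →L[ℝ] TangentSpace 𝓘(ℝ, E) x) : Prop :=
  ∀ (p : M) (U : Set M), IsOpen U → p ∈ U →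
    ∀ θ : Π x : M, TangentSpace 𝓘(ℝ, E) x →L[ℝ] ℂ,
      ContDiffOn ℝ ∞ (covectorInChart p θ)
        ((extChartAt 𝓘(ℝ, E) p).target ∩ (extChartAt 𝓘(ℝ, E) p).symm ⁻¹' U) →
      (∀ q ∈ U, θ q ∈ cotangentType (A q) 1) →
      ∀ v : CTangent (E := E) p, IsOfType (A p) 0 v →
        covDerivForm g θ p (v 0) + Complex.I • covDerivForm g θ p (v 1) ∈
          cotangentType (A p) 1 ⊔ cotangentType (A p) (-1)

/-- The fundamental 2-form `(X, Y) ↦ g(X, A Y)`. -/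
def fundamentalForm [IsManifold 𝓘(ℝ, E) ∞ M]
    (g : ContMDiffRiemannianMetric 𝓘(ℝ, E) ∞ E (fun x : M => TangentSpace 𝓘(ℝ, E) x))
    (A : Π x : M, TangentSpace 𝓘(ℝ, E) x →L[ℝ] TangentSpace 𝓘(ℝ, E) x) (x : M) :
    TangentSpace 𝓘(ℝ, E) x →L[ℝ] TangentSpace 𝓘(ℝ, E) x →L[ℝ] ℝ :=
  ContinuousLinearMap.precomp ℝ (A x) ∘L g.inner x

/-- The complex trilinear extension of the exterior derivative of a real 2-form. -/
def extDerivTwoC (β : Π x : M, TangentSpace 𝓘(ℝ, E) x →L[ℝ] TangentSpace 𝓘(ℝ, E) x →L[ℝ] ℝ)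
    (p : M) (u v w : CTangent (E := E) p) : ℂ :=
  ∑ i : Fin 2, ∑ j : Fin 2, ∑ k : Fin 2,
    Complex.I ^ (i.val + j.val + k.val) * (extDerivTwo β p (u i) (v j) (w k) : ℂ)

/-- `dω^{(1,2)} = 0`: `dω(u, v, w) = 0` whenever `u, v` have the same type (one of `+`, `-`, `0`)
and `w` has a different type, where `ω` is the fundamental 2-form. -/
def FundamentalFormCondition [IsManifold 𝓘(ℝ, E) ∞ M]
    (g : ContMDiffRiemannianMetric 𝓘(ℝ, E) ∞ E (fun x : M => TangentSpace 𝓘(ℝ, E) x))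
    (A : Π x : M, TangentSpace 𝓘(ℝ, E) x →L[ℝ] TangentSpace 𝓘(ℝ, E) x) : Prop :=
  ∀ (p : M) (s t : ℝ), s ∈ ({1, -1, 0} : Set ℝ) → t ∈ ({1, -1, 0} : Set ℝ) → s ≠ t →
    ∀ u v w : CTangent (E := E) p,
      IsOfType (A p) s u → IsOfType (A p) s v → IsOfType (A p) t w →
        extDerivTwoC (fundamentalForm g A) p u v w = 0

end Manifold

/-! ### Complex, Hermitian and Kähler manifolds -/

section Complex

variable {F : Type*} [NormedAddCommGroup F] [NormedSpace ℂ F]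
  {N : Type*} [TopologicalSpace N] [ChartedSpace F N]

/-- A complex manifold is a smooth real manifold. -/
instance [IsManifold 𝓘(ℂ, F) ω N] : IsManifold 𝓘(ℝ, F) ∞ N := by
  refine isManifold_of_contDiffOn 𝓘(ℝ, F) ∞ N fun e e' he he' => ?_
  have h := (contDiffGroupoid ω 𝓘(ℂ, F)).compatible he he'
  rw [contDiffGroupoid, mem_groupoid_of_pregroupoid] at h
  have h1 : ContDiffOn ℂ ω _ _ := h.1
  have h2 := (h1.restrict_scalars ℝ).of_le (m := ∞) le_top
  simpa using h2

/-- The complex structure on the tangent spaces: in a holomorphic chart, multiplication by `i`. -/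
def complexStructure (y : N) : TangentSpace 𝓘(ℝ, F) y →L[ℝ] TangentSpace 𝓘(ℝ, F) y :=
  let J : F →L[ℝ] F := Complex.I • ContinuousLinearMap.id ℝ F
  J

theorem complexStructure_sq (y : N) (v : TangentSpace 𝓘(ℝ, F) y) :
    complexStructure y (complexStructure y v) = -v := by
  have (w : F) : Complex.I • (Complex.I • w) = -w := by
    rw [smul_smul, Complex.I_mul_I, neg_one_smul]
  exact this v

/-- The Riemannian metric `h` is Hermitian: `h(Jv, Jw) = h(v, w)`. -/
def IsHermitian [IsManifold 𝓘(ℂ, F) ω N]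
    (h : ContMDiffRiemannianMetric 𝓘(ℝ, F) ∞ F (fun y : N => TangentSpace 𝓘(ℝ, F) y)) : Prop :=
  ∀ (y : N) (v w : TangentSpace 𝓘(ℝ, F) y),
    h.inner y (complexStructure y v) (complexStructure y w) = h.inner y v w

/-- `h` is a Kähler metric: it is Hermitian and its fundamental 2-form is closed. -/
def IsKahler [IsManifold 𝓘(ℂ, F) ω N]
    (h : ContMDiffRiemannianMetric 𝓘(ℝ, F) ∞ F (fun y : N => TangentSpace 𝓘(ℝ, F) y)) : Prop :=
  IsHermitian h ∧ ∀ (y : N) (u v w : TangentSpace 𝓘(ℝ, F) y),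
    extDerivTwo (fundamentalForm h complexStructure) y u v w = 0

end Complex

/-! ### Maps: tension field, pseudo horizontal weak conformality, associated f-structure -/

section Maps

variable {E : Type*} [NormedAddCommGroup E] [NormedSpace ℝ E] [FiniteDimensional ℝ E]
  {M : Type*} [TopologicalSpace M] [ChartedSpace E M] [IsManifold 𝓘(ℝ, E) ∞ M]
  {F : Type*} [NormedAddCommGroup F]

/-- The tension field at `p` of a map between Riemannian manifolds, in coordinates:
`τ(φ) = g^{ij} (∂_i ∂_j φ - dφ(Γᴹ(∂_i, ∂_j)) + Γᴺ(∂_i φ, ∂_j φ))`. -/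
def tensionField [NormedSpace ℝ F]
    {N : Type*} [TopologicalSpace N] [ChartedSpace F N] [IsManifold 𝓘(ℝ, F) ∞ N]
    (g : ContMDiffRiemannianMetric 𝓘(ℝ, E) ∞ E (fun x : M => TangentSpace 𝓘(ℝ, E) x))
    (h : ContMDiffRiemannianMetric 𝓘(ℝ, F) ∞ F (fun y : N => TangentSpace 𝓘(ℝ, F) y))
    (φ : M → N) (p : M) : TangentSpace 𝓘(ℝ, F) (φ p) :=
  let f : E → F := writtenInExtChartAt 𝓘(ℝ, E) 𝓘(ℝ, F) p φ
  let G := bilinInChart p g.inner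
  let H := bilinInChart (φ p) h.inner
  let u : E := extChartAt 𝓘(ℝ, E) p p
  let τ : F := metricTrace (G u) fun v w =>
    fderiv ℝ (fderiv ℝ f) u v w - fderiv ℝ f u (christoffel G u v w) +
      christoffel H (f u) (fderiv ℝ f u v) (fderiv ℝ f u w)
  τ

/-- A map is harmonic if its tension field vanishes. -/
def IsHarmonic [NormedSpace ℝ F]
    {N : Type*} [TopologicalSpace N] [ChartedSpace F N] [IsManifold 𝓘(ℝ, F) ∞ N]
    (g : ContMDiffRiemannianMetric 𝓘(ℝ, E) ∞ E (fun x : M => TangentSpace 𝓘(ℝ, E) x))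
    (h : ContMDiffRiemannianMetric 𝓘(ℝ, F) ∞ F (fun y : N => TangentSpace 𝓘(ℝ, F) y))
    (φ : M → N) : Prop :=
  ∀ p : M, tensionField g h φ p = 0

variable [NormedSpace ℂ F]
  {N : Type*} [TopologicalSpace N] [ChartedSpace F N] [IsManifold 𝓘(ℂ, F) ω N]

/-- The adjoint `(dφ_p)* : T_{φ(p)}N → T_pM` of the differential: `g((dφ)* w, v) = h(w, dφ v)`. -/
def adjointDifferential
    (g : ContMDiffRiemannianMetric 𝓘(ℝ, E) ∞ E (fun x : M => TangentSpace 𝓘(ℝ, E) x))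
    (h : ContMDiffRiemannianMetric 𝓘(ℝ, F) ∞ F (fun y : N => TangentSpace 𝓘(ℝ, F) y))
    (φ : M → N) (p : M) : TangentSpace 𝓘(ℝ, F) (φ p) →L[ℝ] TangentSpace 𝓘(ℝ, E) p :=
  (g.inner p).inverse ∘L
    (ContinuousLinearMap.precomp ℝ (mfderiv 𝓘(ℝ, E) 𝓘(ℝ, F) φ p) ∘L h.inner (φ p))

/-- Condition (PHWC): `dφ ∘ (dφ)*` commutes with the complex structure. -/
def IsPHWC
    (g : ContMDiffRiemannianMetric 𝓘(ℝ, E) ∞ E (fun x : M => TangentSpace 𝓘(ℝ, E) x))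
    (h : ContMDiffRiemannianMetric 𝓘(ℝ, F) ∞ F (fun y : N => TangentSpace 𝓘(ℝ, F) y))
    (φ : M → N) : Prop :=
  ∀ p : M,
    (mfderiv 𝓘(ℝ, E) 𝓘(ℝ, F) φ p ∘L adjointDifferential g h φ p) ∘L complexStructure (φ p) =
      complexStructure (φ p) ∘L (mfderiv 𝓘(ℝ, E) 𝓘(ℝ, F) φ p ∘L adjointDifferential g h φ p)


variable (F) in
/-- `A` is the endomorphism of `T_pM` determined by the isotropic space `(dφ_p)*(T^{(1,0)*}N)`:
it is skew-symmetric, satisfies `A³ + A = 0`, and the space `T*⁺M` of complex covectors of type `+`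
is the set of pullbacks `η ∘ dφ_p` of the covectors `η` of type `(1,0)` at `φ(p)`. -/
def IsAssociatedAt
    (g : ContMDiffRiemannianMetric 𝓘(ℝ, E) ∞ E (fun x : M => TangentSpace 𝓘(ℝ, E) x))
    (φ : M → N) (p : M) (A : TangentSpace 𝓘(ℝ, E) p →L[ℝ] TangentSpace 𝓘(ℝ, E) p) : Prop :=
  (∀ v w, g.inner p (A v) w = -g.inner p v (A w)) ∧ (∀ v, A (A (A v)) + A v = 0) ∧
    (cotangentType A 1 : Set (TangentSpace 𝓘(ℝ, E) p →L[ℝ] ℂ)) =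
      (fun η => η ∘L mfderiv 𝓘(ℝ, E) 𝓘(ℝ, F) φ p) ''
        (cotangentType (E := F) (complexStructure (φ p)) 1 :
          Set (TangentSpace 𝓘(ℝ, F) (φ p) →L[ℝ] ℂ))

variable (F) in
open Classical in
/-- The f-structure `F^φ` associated to `φ`. Under (PHWC) it exists and is unique, see
`existsUnique_isAssociatedAt`; the value `0` is used where there is none. -/
def associatedFStructure
    (g : ContMDiffRiemannianMetric 𝓘(ℝ, E) ∞ E (fun x : M => TangentSpace 𝓘(ℝ, E) x))
    (φ : M → N) (p : M) : TangentSpace 𝓘(ℝ, E) p →L[ℝ] TangentSpace 𝓘(ℝ, E) p :=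
  if h : ∃ A, IsAssociatedAt F g φ p A then h.choose else 0

/-! Well-definedness of the associated f-structure. -/

theorem exists_fStructure_aux {T W : Type*} [AddCommGroup T] [Module ℝ T] [FiniteDimensional ℝ T]
    [AddCommGroup W] [Module ℝ W] (g : T → T → ℝ) (h : W → W → ℝ)
    (gsymm : ∀ x y, g x y = g y x) (gpos : ∀ x, g x x = 0 → x = 0)
    (hsymm : ∀ x y, h x y = h y x) (hpos : ∀ x, h x x = 0 → x = 0)
    (h0 : ∀ x, h x 0 = 0) (hneg : ∀ x y, h x (-y) = -h x y)
    (J : W →ₗ[ℝ] W) (hJ : ∀ w, J (J w) = -w) (hJh : ∀ v w, h (J v) (J w) = h v w)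
    (A : T →ₗ[ℝ] W) (B : W →ₗ[ℝ] T) (hB : ∀ w x, g (B w) x = h w (A x))
    (hc : ∀ w, A (B (J w)) = J (A (B w))) :
    ∃ P : T →ₗ[ℝ] T, (∀ v w, g (P v) w = -g v (P w)) ∧ (∀ v, P (P (P v)) + P v = 0) ∧
      ∀ θ : T →ₗ[ℝ] ℂ, (∀ x, θ (P x) = Complex.I * θ x) ↔
        ∃ η : W →ₗ[ℝ] ℂ, (∀ w, η (J w) = Complex.I * η w) ∧ ∀ x, θ x = η (A x) := by
  have hker : LinearMap.ker (A ∘ₗ B ∘ₗ A) = LinearMap.ker A := by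
    ext x
    simp only [LinearMap.mem_ker, LinearMap.comp_apply]
    refine ⟨fun hx => ?_, fun hx => by simp [hx]⟩
    have h1 : B (A x) = 0 := gpos _ (by rw [hB, hx, h0])
    apply hpos
    rw [← hB, h1]
    have := hB 0 x
    rw [map_zero] at this
    rw [this, hsymm, h0]
  have hrange : LinearMap.range (A ∘ₗ B ∘ₗ A) = LinearMap.range A := by
    apply Submodule.eq_of_le_of_finrank_eq
    · rintro _ ⟨x, rfl⟩
      exact ⟨B (A x), rfl⟩
    · have e1 := LinearMap.finrank_range_add_finrank_ker (A ∘ₗ B ∘ₗ A)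
      have e2 := LinearMap.finrank_range_add_finrank_ker A
      rw [hker] at e1
      omega
  have hw : ∀ x, ∃ w, A (B w) = A x := by
    intro x
    have : A x ∈ LinearMap.range (A ∘ₗ B ∘ₗ A) := hrange ▸ ⟨x, rfl⟩
    obtain ⟨y, hy⟩ := this
    exact ⟨A y, hy⟩
  choose c hcx using hw
  have huniq : ∀ w w', A (B w) = A (B w') → B w = B w' := by
    intro w w' e
    have e1 : A (B (w - w')) = 0 := by simp [e]
    have : B (w - w') = 0 := gpos _ (by rw [hB, e1, h0])
    rwa [map_sub, sub_eq_zero] at this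
  let P : T →ₗ[ℝ] T :=
    { toFun := fun x => B (J (c x))
      map_add' := fun x y => by
        rw [← map_add, ← map_add]
        apply huniq
        rw [hc, hc]
        simp [hcx]
      map_smul' := fun r x => by
        simp only [RingHom.id_apply]
        rw [← map_smul, ← map_smul]
        apply huniq
        rw [hc, hc]
        simp [hcx] }
  have hP : ∀ x, P x = B (J (c x)) := fun x => rfl
  have hAP : ∀ x, A (P x) = J (A x) := fun x => by rw [hP, hc, hcx]
  have hJ' : ∀ v w, h v (J w) = -h (J v) w := by
    intro v w
    rw [← hJh v (J w), hJ, hneg]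
  refine ⟨P, fun v w => ?_, fun v => ?_, fun θ => ⟨fun hθ => ?_, ?_⟩⟩
  · rw [hP, hB, ← hcx w, hP, gsymm v, hB, ← hcx v, hsymm (J (c w)), ← neg_eq_iff_eq_neg,
      ← hJ', ← hc]
    have a1 := hB (c v) (B (J (c w)))
    have a2 := hB (J (c w)) (B (c v))
    rw [← a1, gsymm, a2, hsymm]
  · rw [← eq_neg_iff_add_eq_zero, hP (P (P v))]
    change _ = -B (J (c v))
    rw [← map_neg]
    apply huniq
    rw [hc, hcx, hAP, hAP, hJ, map_neg, map_neg, hc, hcx]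
  · have hk : ∀ x, A x = 0 → θ x = 0 := by
      intro x hx
      have : P x = 0 := by
        rw [hP, ← map_zero B]
        apply huniq
        rw [hc, hcx, hx]
        simp
      have := hθ x
      simp_all
    obtain ⟨s, hs⟩ := A.rangeRestrict.exists_rightInverse_of_surjective A.range_rangeRestrict
    obtain ⟨Q, hQ⟩ := LinearMap.exists_extend s
    have hAQ : ∀ x, A (Q (A x)) = A x := by
      intro x
      have e1 := LinearMap.congr_fun hQ ⟨A x, x, rfl⟩
      have e2 := congrArg Subtype.val (LinearMap.congr_fun hs ⟨A x, x, rfl⟩)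
      simp only [LinearMap.comp_apply, Submodule.subtype_apply] at e1
      rw [e1]
      simpa using e2
    have hθQ : ∀ x, θ (Q (A x)) = θ x := by
      intro x
      have := hk (Q (A x) - x) (by simp [hAQ])
      rwa [map_sub, sub_eq_zero] at this
    refine ⟨(1 / 2 : ℝ) • (θ ∘ₗ Q - (Complex.I • θ) ∘ₗ Q ∘ₗ J), fun w => ?_, fun x => ?_⟩
    · simp [hJ]
      ring_nf
      simp
      ring
    · have : θ (Q (J (A x))) = Complex.I * θ x := by rw [← hAP, hθQ, hθ]
      simp [this, hθQ, ← mul_assoc]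
      ring
  · rintro ⟨η, h1, h2⟩ x
    rw [h2, hAP, h1, h2]

theorem isInvertible_of_pos {V : Type*} [NormedAddCommGroup V] [NormedSpace ℝ V]
    [FiniteDimensional ℝ V] (G : V →L[ℝ] V →L[ℝ] ℝ) (hG : ∀ v, v ≠ 0 → 0 < G v v) :
    G.IsInvertible := by
  have hinj : Function.Injective (G : V →ₗ[ℝ] V →L[ℝ] ℝ) := by
    rw [injective_iff_map_eq_zero]
    intro v hv
    by_contra hne
    have := hG v hne
    have hv' : G v = 0 := hv
    simp [hv'] at this
  have hdim : Module.finrank ℝ V = Module.finrank ℝ (V →L[ℝ] ℝ) := by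
    rw [← (LinearMap.toContinuousLinearMap (𝕜 := ℝ) (E := V) (F' := ℝ)).finrank_eq]
    exact (Subspace.dual_finrank_eq (K := ℝ) (V := V)).symm
  let e := LinearEquiv.ofInjectiveOfFinrankEq _ hinj hdim
  exact ⟨e.toContinuousLinearEquiv, by ext; rfl⟩

theorem adjointDifferential_spec
    (g : ContMDiffRiemannianMetric 𝓘(ℝ, E) ∞ E (fun x : M => TangentSpace 𝓘(ℝ, E) x))
    (h : ContMDiffRiemannianMetric 𝓘(ℝ, F) ∞ F (fun y : N => TangentSpace 𝓘(ℝ, F) y))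
    (φ : M → N) (p : M) (w : TangentSpace 𝓘(ℝ, F) (φ p)) (v : TangentSpace 𝓘(ℝ, E) p) :
    g.inner p (adjointDifferential g h φ p w) v =
      h.inner (φ p) w (mfderiv 𝓘(ℝ, E) 𝓘(ℝ, F) φ p v) := by
  have hi : (g.inner p).IsInvertible := isInvertible_of_pos (V := E) (g.inner p) (g.pos p)
  obtain ⟨e, he⟩ := hi
  simp [adjointDifferential, ← he]

theorem isAssociatedAt_unique
    (g : ContMDiffRiemannianMetric 𝓘(ℝ, E) ∞ E (fun x : M => TangentSpace 𝓘(ℝ, E) x))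
    (φ : M → N) (p : M) (A B : TangentSpace 𝓘(ℝ, E) p →L[ℝ] TangentSpace 𝓘(ℝ, E) p)
    (hA : IsAssociatedAt F g φ p A) (hB : IsAssociatedAt F g φ p B) : A = B := by
  obtain ⟨a1, a2, a3⟩ := hA
  obtain ⟨b1, b2, b3⟩ := hB
  have hAB : ∀ θ, θ ∈ cotangentType A 1 ↔ θ ∈ cotangentType B 1 := fun θ => by
    rw [← SetLike.mem_coe, ← SetLike.mem_coe, a3, b3]
  have key : ∀ (C : TangentSpace 𝓘(ℝ, E) p →L[ℝ] TangentSpace 𝓘(ℝ, E) p),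
      (∀ v, C (C (C v)) + C v = 0) → ∀ d, (∀ θ ∈ cotangentType C 1, θ d = 0) → C d = 0 := by
    intro C hC d hd
    by_contra hne
    let l : TangentSpace 𝓘(ℝ, E) p →L[ℝ] ℝ := g.inner p (C d)
    have hl := hd ((Complex.ofRealCLM ∘L l ∘L C) -
        Complex.I • (Complex.ofRealCLM ∘L l ∘L C ∘L C)) (by
      intro v
      have : C (C (C v)) = -C v := eq_neg_of_add_eq_zero_left (hC v)
      simp [this, mul_sub, ← mul_assoc]
      ring)
    have h2 := congrArg Complex.re hl
    simp [l] at h2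
    have := g.pos p (C d) hne
    linarith
  ext x
  have hd : ∀ θ ∈ cotangentType A 1, θ (A x - B x) = 0 := by
    intro θ hθ
    have e1 : θ (A x) = _ := hθ x
    have e2 : θ (B x) = _ := (hAB θ).1 hθ x
    rw [map_sub, e1, e2, sub_self]
  have h1 := key A a2 _ hd
  have h2 := key B b2 _ (fun θ hθ => hd θ ((hAB θ).2 hθ))
  by_contra hne
  have hpos := g.pos p _ (sub_ne_zero.2 hne)
  have e1 := a1 x (A x - B x)
  have e2 := b1 x (A x - B x)
  rw [h1] at e1
  rw [h2] at e2
  have e3 : g.inner p (A x - B x) (A x - B x) = 0 := by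
    have : g.inner p (A x - B x) = g.inner p (A x) - g.inner p (B x) := map_sub _ _ _
    conv_lhs => rw [this]
    rw [sub_apply, e1, e2]
    simp
  exact absurd e3 hpos.ne'

/-- Under (PHWC), for a Hermitian target, there is exactly one endomorphism of `T_pM` associated
to `φ`. -/
theorem existsUnique_isAssociatedAt [FiniteDimensional ℂ F]
    (g : ContMDiffRiemannianMetric 𝓘(ℝ, E) ∞ E (fun x : M => TangentSpace 𝓘(ℝ, E) x))
    (h : ContMDiffRiemannianMetric 𝓘(ℝ, F) ∞ F (fun y : N => TangentSpace 𝓘(ℝ, F) y))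
    (hh : IsHermitian h) (φ : M → N) (hφ : IsPHWC g h φ) (p : M) :
    ∃! A, IsAssociatedAt F g φ p A := by
  have : FiniteDimensional ℝ (TangentSpace 𝓘(ℝ, E) p) := inferInstanceAs (FiniteDimensional ℝ E)
  have : T2Space (TangentSpace 𝓘(ℝ, E) p) := inferInstanceAs (T2Space E)
  have : FiniteDimensional ℝ F := FiniteDimensional.complexToReal F
  have : FiniteDimensional ℝ (TangentSpace 𝓘(ℝ, F) (φ p)) :=
    inferInstanceAs (FiniteDimensional ℝ F)
  have : T2Space (TangentSpace 𝓘(ℝ, F) (φ p)) := inferInstanceAs (T2Space F)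
  obtain ⟨P, h1, h2, h3⟩ := exists_fStructure_aux
    (fun v w => g.inner p v w) (fun v w => h.inner (φ p) v w)
    (fun v w => g.symm p v w)
    (fun v hv => by by_contra hne; exact (g.pos p v hne).ne' hv)
    (fun v w => h.symm (φ p) v w)
    (fun v hv => by by_contra hne; exact (h.pos (φ p) v hne).ne' hv)
    (fun v => map_zero _) (fun v w => map_neg _ _)
    (complexStructure (φ p)).toLinearMap
    (fun w => complexStructure_sq (φ p) w)
    (fun v w => hh (φ p) v w)
    (mfderiv 𝓘(ℝ, E) 𝓘(ℝ, F) φ p).toLinearMap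
    (adjointDifferential g h φ p).toLinearMap
    (fun w v => adjointDifferential_spec g h φ p w v)
    (fun w => DFunLike.congr_fun (hφ p) w)
  refine ⟨LinearMap.toContinuousLinearMap P, ⟨h1, h2, ?_⟩,
    fun B hB => isAssociatedAt_unique g φ p _ _ hB ⟨h1, h2, ?_⟩⟩
  all_goals
    ext θ
    have h3' := h3 θ
    constructor
    · intro hθ
      obtain ⟨η, e1, e2⟩ := h3'.1 (fun x => by
        have := hθ x
        simpa using this)
      refine ⟨LinearMap.toContinuousLinearMap η, fun w => ?_, ?_⟩
      · simpa using e1 w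
      · ext x
        exact (e2 x).symm
    · rintro ⟨η, e1, rfl⟩ x
      have := h3'.2 ⟨η, fun w => by simpa using e1 w, fun x => rfl⟩ x
      simpa using this

/-- Under (PHWC), for a Hermitian target, `F^φ` has its defining properties. -/
theorem associatedFStructure_spec [FiniteDimensional ℂ F]
    (g : ContMDiffRiemannianMetric 𝓘(ℝ, E) ∞ E (fun x : M => TangentSpace 𝓘(ℝ, E) x))
    (h : ContMDiffRiemannianMetric 𝓘(ℝ, F) ∞ F (fun y : N => TangentSpace 𝓘(ℝ, F) y))
    (hh : IsHermitian h) (φ : M → N) (hφ : IsPHWC g h φ) (p : M) :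
    IsAssociatedAt F g φ p (associatedFStructure F g φ p) := by
  have hex := (existsUnique_isAssociatedAt g h hh φ hφ p).exists
  rw [associatedFStructure, dif_pos hex]
  exact hex.choose_spec

end Maps

end PHM

end

set_option linter.unusedSectionVars false

noncomputable section

namespace PHM

/-! ### Metric traces and the Levi-Civita connection in coordinates -/

section Coordinate

variable {E : Type*} [NormedAddCommGroup E] [NormedSpace ℝ E] [FiniteDimensional ℝ E]

/-! The associated f-structure `A` makes the map holomorphic, `dφ ∘ A = J ∘ dφ`
(`IsAssociatedAt.mfderiv_apply`); in particular `dφ` kills `ker A`. Since `A` is skew with `A³ =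
-A`, the tangent space is the orthogonal sum of `ker A` and `range A`. So the trace of `B = ∇dφ`
vanishes as soon as `B = 0` on `ker A` and `B(x, y) + B(Ax, Ay) = 0` on `range A`
(`metricTrace_eq_zero`).

On `ker A`, condition 2 is applied to pullbacks `θ = η ∘ dφ` with `η` of type (1,0). The covector
`∇_v θ` lies in `T*⁺ + T*⁻`, hence vanishes on `ker A`. As such `η` separate vectors, `B(v, w) = 0`
(`CovDerivZeroPlusCondition.coord`).

On `range A`, differentiating `dφ ∘ A = J ∘ dφ` and using `∇J = 0` on the Kähler target
(`christoffel_map_of_closed`) gives `B(x, Ay) = J B(x, y) - dφ((∇_x A) y)`. Condition 3 makes `(∇_x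
A) y + (∇_{Ax} A) Ay` orthogonal to `range A` (`apply_covDerivEnd_add_eq_zero`), so `dφ` kills it.
With `Ax` in place of `x` this yields `B(x, y) + B(Ax, Ay) = J (B(Ax, y) - B(x, Ay))`. The left side
is symmetric in `x, y` and the right side antisymmetric, so both vanish
(`metricTrace_coordHessian_eq_zero`).

Integrability supplies the differentiability of `A`, without which `∇A` makes no sense
(`differentiableAt_endInChart`). -/

theorem apply_inverse_of_pos {G : E →L[ℝ] E →L[ℝ] ℝ} (hpos : ∀ v, v ≠ 0 → 0 < G v v)
    (l : E →L[ℝ] ℝ) : G (G.inverse l) = l := by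
  obtain ⟨e, he⟩ := isInvertible_of_pos G hpos
  simp [← he]

theorem eq_of_forall_apply_eq {G : E →L[ℝ] E →L[ℝ] ℝ} (hpos : ∀ v, v ≠ 0 → 0 < G v v)
    {v w : E} (h : ∀ z, G v z = G w z) : v = w := by
  by_contra hne
  have := hpos _ (sub_ne_zero.2 hne)
  have e : G (v - w) (v - w) = 0 := by
    rw [map_sub G, sub_apply, h, sub_self]
  rw [e] at this
  exact this.false

/-- This replaces the choice of an orthonormal basis adapted to `A`: all splitting of traces is done
by moving operators from one slot to the other as adjoints. -/
theorem metricTrace_comp_left {G : E →L[ℝ] E →L[ℝ] ℝ} (hpos : ∀ v, v ≠ 0 → 0 < G v v)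
    (hsymm : ∀ v w, G v w = G w v) {W : Type*} [AddCommGroup W] [Module ℝ W]
    (B : E →ₗ[ℝ] E →ₗ[ℝ] W) (C C' : E →L[ℝ] E) (hC : ∀ v w, G (C v) w = G v (C' w)) :
    metricTrace G (fun v w => B (C v) w) = metricTrace G (fun v w => B v (C' w)) := by
  set b := Module.finBasis ℝ E with hb
  have h1 : ∀ i, C (b i) = ∑ j, b.coord j (C (b i)) • b j := fun i =>
    (b.sum_repr (C (b i))).symm
  -- In the basis metrically dual to `b`, the adjoint `C'` has the transposed matrix of `C`.
  have h2 : ∀ j, C' (G.inverse (LinearMap.toContinuousLinearMap (b.coord j))) =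
      ∑ i, b.coord j (C (b i)) •
        G.inverse (LinearMap.toContinuousLinearMap (b.coord i)) := by
    intro j
    refine eq_of_forall_apply_eq hpos fun z => ?_
    rw [hsymm, ← hC, hsymm, apply_inverse_of_pos hpos, map_sum]
    simp only [map_smul, sum_apply, smul_apply, apply_inverse_of_pos hpos,
      LinearMap.coe_toContinuousLinearMap', smul_eq_mul]
    conv_lhs => rw [← b.sum_repr z]
    simp only [map_sum, map_smul, smul_eq_mul]
    exact Finset.sum_congr rfl fun i _ => mul_comm _ _
  simp only [metricTrace, ← hb]
  calc _ = ∑ i, ∑ j, b.coord j (C (b i)) •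
        B (b j) (G.inverse (LinearMap.toContinuousLinearMap (b.coord i))) := by
        refine Finset.sum_congr rfl fun i _ => ?_
        conv_lhs => rw [h1 i]
        simp only [map_sum, map_smul, LinearMap.sum_apply, LinearMap.smul_apply]
    _ = _ := by
        rw [Finset.sum_comm]
        refine Finset.sum_congr rfl fun j _ => ?_
        rw [h2 j]
        simp only [map_sum, map_smul]

theorem metricTrace_add (G : E →L[ℝ] E →L[ℝ] ℝ) {W : Type*} [AddCommGroup W]
    (B C : E → E → W) :
    metricTrace G (fun v w => B v w + C v w) = metricTrace G B + metricTrace G C := by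
  simp [metricTrace, Finset.sum_add_distrib]

/-- A bilinear map that vanishes on the kernel of a skew f-structure and is of mixed type on its
range is trace-free. -/
theorem metricTrace_eq_zero {G : E →L[ℝ] E →L[ℝ] ℝ} (hpos : ∀ v, v ≠ 0 → 0 < G v v)
    (hsymm : ∀ v w, G v w = G w v) {W : Type*} [AddCommGroup W] [Module ℝ W]
    (B : E →ₗ[ℝ] E →ₗ[ℝ] W) (A : E →L[ℝ] E) (hskew : ∀ v w, G (A v) w = -G v (A w))
    (hcube : ∀ v, A (A (A v)) = -A v) (hker : ∀ v w, A v = 0 → A w = 0 → B v w = 0)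
    (hrange : ∀ v w, A (A v) = -v → A (A w) = -w → B v w + B (A v) (A w) = 0) :
    metricTrace G (fun v w => B v w) = 0 := by
  -- The orthogonal projections onto `range A` and `ker A` are `-A²` and `1 + A²`. The three
  -- identities bring traces over these subspaces to the form `B v (P w)` with `P` one of the
  -- projections.
  have t1 : metricTrace G (fun v w => B (A v) (A w)) =
      metricTrace G (fun v w => B v (-(A (A w)))) :=
    metricTrace_comp_left hpos hsymm (B.compl₂ A.toLinearMap) A (-A)
      (fun v w => by simp [hskew]) |>.trans (by simp)
  have t2 : metricTrace G (fun v w => B (A (A v)) (A (A w))) =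
      metricTrace G (fun v w => B v (-(A (A w)))) := by
    have := metricTrace_comp_left hpos hsymm (B.compl₂ (A.toLinearMap ∘ₗ A.toLinearMap))
      (A ∘L A) (A ∘L A) (fun v w => by simp [hskew])
    simpa [hcube] using this
  have t3 : metricTrace G (fun v w => B (v + A (A v)) (w + A (A w))) =
      metricTrace G (fun v w => B v (w + A (A w))) := by
    have := metricTrace_comp_left hpos hsymm
      (B.compl₂ (LinearMap.id + A.toLinearMap ∘ₗ A.toLinearMap))
      (ContinuousLinearMap.id ℝ E + A ∘L A) (ContinuousLinearMap.id ℝ E + A ∘L A)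
      (fun v w => by simp [hskew])
    simpa [hcube] using this
  have z1 : metricTrace G (fun v w => B v (w + A (A w))) = 0 := by
    rw [← t3]
    refine Finset.sum_eq_zero fun i _ => hker _ _ ?_ ?_ <;> simp [hcube]
  -- Both `t1` and `t2` have this right-hand side. Adding their left sides and applying `hrange` to
  -- the vectors `A² v`, `A² w` gives zero, because `A (A² v) = -A v`.
  have z2 : metricTrace G (fun v w => B v (-(A (A w)))) +
      metricTrace G (fun v w => B v (-(A (A w)))) = 0 := by
    conv_lhs => rw [← t2]
    rw [t2, ← t1]
    nth_rewrite 1 [t1]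
    rw [← t2, ← metricTrace_add]
    refine Finset.sum_eq_zero fun i _ => ?_
    have := hrange (A (A (Module.finBasis ℝ E i))) (A (A (G.inverse
      (LinearMap.toContinuousLinearMap ((Module.finBasis ℝ E).coord i))))) (by simp [hcube])
      (by simp [hcube])
    simpa [hcube] using this
  have z3 : metricTrace G (fun v w => B v (-(A (A w)))) = 0 := by
    rw [← two_smul ℝ] at z2
    exact (smul_eq_zero.1 z2).resolve_left two_ne_zero
  have := metricTrace_add G (fun v w => B v (w + A (A w))) (fun v w => B v (-(A (A w))))
  rw [z1, z3, add_zero] at this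
  rw [← this]
  simp

theorem christoffel_spec {G : E → E →L[ℝ] E →L[ℝ] ℝ} {u : E}
    (hpos : ∀ v, v ≠ 0 → 0 < G u v v) (v w z : E) :
    G u (christoffel G u v w) z =
      1 / 2 * (fderiv ℝ G u v w z + fderiv ℝ G u w v z - fderiv ℝ G u z v w) := by
  unfold christoffel
  rw [ContinuousLinearMap.comp_apply, apply_inverse_of_pos hpos]
  rfl

theorem fderiv_apply_apply {V W₁ W₂ X : Type*} [NormedAddCommGroup V] [NormedSpace ℝ V]
    [NormedAddCommGroup W₁] [NormedSpace ℝ W₁] [NormedAddCommGroup W₂] [NormedSpace ℝ W₂]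
    [NormedAddCommGroup X] [NormedSpace ℝ X]
    {G : V → W₁ →L[ℝ] W₂ →L[ℝ] X} {u : V} (hG : DifferentiableAt ℝ G u)
    {a : V → W₁} {b : V → W₂} (ha : DifferentiableAt ℝ a u) (hb : DifferentiableAt ℝ b u) (x : V) :
    fderiv ℝ (fun u => G u (a u) (b u)) u x =
      fderiv ℝ G u x (a u) (b u) + G u (fderiv ℝ a u x) (b u) + G u (a u) (fderiv ℝ b u x) := by
  rw [fderiv_clm_apply (hG.clm_apply ha) hb, fderiv_clm_apply hG ha]
  simp
  abel

theorem fderiv_apply {V W₁ X : Type*} [NormedAddCommGroup V] [NormedSpace ℝ V]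
    [NormedAddCommGroup W₁] [NormedSpace ℝ W₁]
    [NormedAddCommGroup X] [NormedSpace ℝ X]
    {G : V → W₁ →L[ℝ] X} {u : V} (hG : DifferentiableAt ℝ G u)
    {a : V → W₁} (ha : DifferentiableAt ℝ a u) (x : V) :
    fderiv ℝ (fun u => G u (a u)) u x = fderiv ℝ G u x (a u) + G u (fderiv ℝ a u x) := by
  rw [fderiv_clm_apply hG ha]
  simp
  abel

theorem fderiv_metric_symm {G : E → E →L[ℝ] E →L[ℝ] ℝ} {u : E} (hG : DifferentiableAt ℝ G u)
    (hsymm : ∀ᶠ y in 𝓝 u, ∀ v w, G y v w = G y w v) (x v w : E) :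
    fderiv ℝ G u x v w = fderiv ℝ G u x w v := by
  have h1 : (fun y => G y v w) =ᶠ[𝓝 u] fun y => G y w v := hsymm.mono fun y hy => hy v w
  have h2 := DFunLike.congr_fun (h1.fderiv_eq (𝕜 := ℝ)) x
  rw [fderiv_apply_apply hG (differentiableAt_const v) (differentiableAt_const w),
    fderiv_apply_apply hG (differentiableAt_const w) (differentiableAt_const v)] at h2
  simpa using h2

theorem christoffel_symm {G : E → E →L[ℝ] E →L[ℝ] ℝ} {u : E} (hG : DifferentiableAt ℝ G u)
    (hpos : ∀ v, v ≠ 0 → 0 < G u v v) (hsymm : ∀ᶠ y in 𝓝 u, ∀ v w, G y v w = G y w v) (v w : E) :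
    christoffel G u v w = christoffel G u w v := by
  refine eq_of_forall_apply_eq hpos fun z => ?_
  rw [christoffel_spec hpos, christoffel_spec hpos, fderiv_metric_symm hG hsymm z v w]
  ring

/-- The Levi-Civita connection is metric. -/
theorem fderiv_metric {G : E → E →L[ℝ] E →L[ℝ] ℝ} {u : E} (hG : DifferentiableAt ℝ G u)
    (hpos : ∀ v, v ≠ 0 → 0 < G u v v) (hsymm : ∀ᶠ y in 𝓝 u, ∀ v w, G y v w = G y w v)
    (x v w : E) :
    fderiv ℝ G u x v w = G u (christoffel G u x v) w + G u v (christoffel G u x w) := by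
  rw [hsymm.self_of_nhds v, christoffel_spec hpos, christoffel_spec hpos,
    fderiv_metric_symm hG hsymm x w v, fderiv_metric_symm hG hsymm v x w,
    fderiv_metric_symm hG hsymm w x v]
  ring

/-- The covariant derivative of a field of endomorphisms. -/
def covDerivEnd (G : E → E →L[ℝ] E →L[ℝ] ℝ) (A : E → E →L[ℝ] E) (u x y : E) : E :=
  fderiv ℝ A u x y + christoffel G u x (A u y) - A u (christoffel G u x y)

/-! ### The covariant derivative of an f-structure and the exterior derivative of its fundamental
form -/

section

variable {G : E → E →L[ℝ] E →L[ℝ] ℝ} {A : E → E →L[ℝ] E} {u : E} (hG : DifferentiableAt ℝ G u)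
    (hpos : ∀ v, v ≠ 0 → 0 < G u v v) (hsymm : ∀ᶠ y in 𝓝 u, ∀ v w, G y v w = G y w v)
    (hA : DifferentiableAt ℝ A u) (hskew : ∀ᶠ y in 𝓝 u, ∀ v w, G y (A y v) w = -G y v (A y w))
    (hcube : ∀ᶠ y in 𝓝 u, ∀ v, A y (A y (A y v)) = -A y v)

include hA hcube in
-- The Leibniz rule applied to `A³ = -A`. The Christoffel terms telescope.
theorem covDerivEnd_cube (x v : E) :
    covDerivEnd G A u x (A u (A u v)) + A u (covDerivEnd G A u x (A u v)) +
      A u (A u (covDerivEnd G A u x v)) = -covDerivEnd G A u x v := by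
  have h1 : (fun y => A y (A y (A y v))) =ᶠ[𝓝 u] fun y => -A y v :=
    hcube.mono fun y hy => hy v
  have h2 := DFunLike.congr_fun (h1.fderiv_eq (𝕜 := ℝ)) x
  have dv := differentiableAt_const (𝕜 := ℝ) (x := u) v
  rw [fderiv_fun_neg, neg_apply, fderiv_apply hA (hA.clm_apply (hA.clm_apply dv)),
    fderiv_apply hA (hA.clm_apply dv), fderiv_apply hA dv] at h2
  simp only [fderiv_fun_const, Pi.zero_apply, zero_apply, map_zero, add_zero, map_add] at h2
  have h3 := hcube.self_of_nhds
  simp only [covDerivEnd, map_add, map_sub, h3, map_neg]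
  rw [← sub_eq_zero] at h2 ⊢
  rw [← h2]
  abel

include hG hpos hsymm hA hskew in
-- As the connection is torsion-free, partial derivatives in `dω` may be replaced by covariant ones;
-- as it is metric, `(∇_x ω)(y, z) = G(y, (∇_x A) z)`. The last term carries a plus sign because
-- `∇_z A` is skew.
theorem coordExtDeriv_eq {β : E → E →L[ℝ] E →L[ℝ] ℝ}
    (hβ : ∀ᶠ y in 𝓝 u, ∀ v w, β y v w = G y v (A y w)) (hβd : DifferentiableAt ℝ β u)
    (x y z : E) :
    coordExtDeriv β u x y z = G u y (covDerivEnd G A u x z) - G u x (covDerivEnd G A u y z) +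
      G u x (covDerivEnd G A u z y) := by
  have key : ∀ x y z, fderiv ℝ β u x y z = G u (christoffel G u x y) (A u z) +
      G u y (covDerivEnd G A u x z) + G u y (A u (christoffel G u x z)) := by
    intro x y z
    have h1 : (fun p => β p y z) =ᶠ[𝓝 u] fun p => G p y (A p z) := hβ.mono fun p hp => hp y z
    have h2 := DFunLike.congr_fun (h1.fderiv_eq (𝕜 := ℝ)) x
    have dy := differentiableAt_const (𝕜 := ℝ) (x := u) y
    have dz := differentiableAt_const (𝕜 := ℝ) (x := u) z
    rw [fderiv_apply_apply hβd dy dz,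
      fderiv_apply_apply hG dy (hA.clm_apply dz), fderiv_apply hA dz,
      fderiv_metric hG hpos hsymm] at h2
    simp only [fderiv_fun_const, Pi.zero_apply, zero_apply, map_zero, add_zero] at h2
    rw [h2]
    simp only [covDerivEnd, map_add, map_sub]
    ring
  have h3 := hskew.self_of_nhds
  have h4 := hsymm.self_of_nhds
  have c := christoffel_symm hG hpos hsymm
  simp only [coordExtDeriv, key]
  rw [c z x, c z y, c y x, ← neg_eq_iff_eq_neg.2 (h3 y _), ← neg_eq_iff_eq_neg.2 (h3 x _),
    h4 (A u x) (christoffel G u y z), h4 (A u y)]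
  have h5 := h3 (christoffel G u x z) y
  have h6 := h3 x (christoffel G u y z)
  rw [h4 (A u x)] at h6
  have h7 := h4 (christoffel G u x z) (A u y)
  have h8 := h4 (A u (christoffel G u x z)) y
  linarith

end

end Coordinate

/-! ### The second fundamental form and its trace -/

section CoordinateTension

variable {E : Type*} [NormedAddCommGroup E] [NormedSpace ℝ E] [FiniteDimensional ℝ E]

section

variable {G : E → E →L[ℝ] E →L[ℝ] ℝ} {A : E → E →L[ℝ] E} {u : E} (hG : DifferentiableAt ℝ G u)
    (hpos : ∀ v, v ≠ 0 → 0 < G u v v) (hsymm : ∀ᶠ y in 𝓝 u, ∀ v w, G y v w = G y w v)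
    (hA : DifferentiableAt ℝ A u) (hskew : ∀ᶠ y in 𝓝 u, ∀ v w, G y (A y v) w = -G y v (A y w))
    (hcube : ∀ᶠ y in 𝓝 u, ∀ v, A y (A y (A y v)) = -A y v)

include hA hskew hcube in
-- On `range A` the endomorphism `A` is a complex structure. Compressed to that subspace, `∇_x A`
-- anticommutes with it, so `G(·, (∇_x A) ·)` has no part of mixed type there.
theorem apply_covDerivEnd_of_range (x : E) {v w : E} (hv : A u (A u v) = -v)
    (hw : A u (A u w) = -w) :
    G u (A u v) (covDerivEnd G A u x (A u w)) = -G u v (covDerivEnd G A u x w) := by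
  have h1 := covDerivEnd_cube (G := G) hA hcube x w
  have hs := hskew.self_of_nhds
  have hn : covDerivEnd G A u x (-w) = -covDerivEnd G A u x w := by
    simp only [covDerivEnd, map_neg]
    abel
  rw [hw, hn] at h1
  have h2 : A u (covDerivEnd G A u x (A u w)) = -A u (A u (covDerivEnd G A u x w)) := by
    rw [← sub_eq_zero] at h1 ⊢
    rw [← h1]
    abel
  rw [hs, h2, map_neg, neg_neg, ← neg_eq_iff_eq_neg.2 (hs v _), ← neg_eq_iff_eq_neg.2 (hs _ _), hv]
  simp

include hG hpos hsymm hA hskew hcube in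
/-- If the part of type `(-, -, +)` of the exterior derivative of the fundamental form vanishes,
then so does the part of type `(-, +, -)` of the covariant derivative of the f-structure. -/
theorem apply_covDerivEnd_add_eq_zero {β : E → E →L[ℝ] E →L[ℝ] ℝ}
    (hβ : ∀ᶠ y in 𝓝 u, ∀ v w, β y v w = G y v (A y w)) (hβd : DifferentiableAt ℝ β u)
    (hform : ∀ x y z, A u (A u x) = -x → A u (A u y) = -y → A u (A u z) = -z →
      coordExtDeriv β u x y z - coordExtDeriv β u (A u x) (A u y) z +
      coordExtDeriv β u (A u x) y (A u z) + coordExtDeriv β u x (A u y) (A u z) = 0)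
    {x y w : E} (hx : A u (A u x) = -x) (hy : A u (A u y) = -y) (hw : A u (A u w) = -w) :
    G u w (covDerivEnd G A u x y + covDerivEnd G A u (A u x) (A u y)) = 0 := by
  -- In the expansion through `∇A`, the terms differentiated along `w, y, Aw, Ay` cancel in pairs by
  -- the type property `q`. Those along `x` and `Ax` double up to twice the claim.
  have h := hform w y x hw hy hx
  have hn (z v : E) : covDerivEnd G A u z (-v) = -covDerivEnd G A u z v := by
    simp only [covDerivEnd, map_neg]
    abel
  have q (z : E) {v w : E} (hv : A u (A u v) = -v) (hw : A u (A u w) = -w) :=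
    apply_covDerivEnd_of_range hA hskew hcube z hv hw
  simp only [coordExtDeriv_eq hG hpos hsymm hA hskew hβ hβd] at h
  have e1 := q w hy hx
  have e2 := q y hw hx
  have e3 := q (A u w) hy (w := A u x) (by rw [hx, map_neg])
  have e4 := q (A u y) hw (w := A u x) (by rw [hx, map_neg])
  have e5 := q x hw hy
  have e6 := q (A u x) hw (w := A u y) (by rw [hy, map_neg])
  simp only [hx, hy, hn, map_neg] at e3 e4 e6
  rw [map_add]
  linarith

end

/-- On a Kähler manifold, in holomorphic coordinates, the Christoffel symbols are complex
bilinear. -/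
theorem christoffel_map_of_closed {H : E → E →L[ℝ] E →L[ℝ] ℝ} {u : E}
    (hH : DifferentiableAt ℝ H u) (hpos : ∀ v, v ≠ 0 → 0 < H u v v)
    (hsymm : ∀ᶠ y in 𝓝 u, ∀ v w, H y v w = H y w v) (J : E →L[ℝ] E) (hJ : ∀ v, J (J v) = -v)
    (hherm : ∀ᶠ y in 𝓝 u, ∀ v w, H y (J v) (J w) = H y v w) {β : E → E →L[ℝ] E →L[ℝ] ℝ}
    (hβ : ∀ᶠ y in 𝓝 u, ∀ v w, β y v w = H y v (J w)) (hβd : DifferentiableAt ℝ β u)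
    (hclosed : ∀ x y z, coordExtDeriv β u x y z = 0) (v w : E) :
    christoffel H u v (J w) = J (christoffel H u v w) := by
  have d (z : E) := differentiableAt_const (𝕜 := ℝ) (x := u) z
  have e1 (x y z : E) : fderiv ℝ β u x y z = fderiv ℝ H u x y (J z) := by
    have h1 : (fun p => β p y z) =ᶠ[𝓝 u] fun p => H p y (J z) := hβ.mono fun p hp => hp y z
    have h2 := DFunLike.congr_fun (h1.fderiv_eq (𝕜 := ℝ)) x
    rw [fderiv_apply_apply hβd (d y) (d z), fderiv_apply_apply hH (d y) (d (J z))] at h2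
    simpa using h2
  have e2 (x y z : E) : fderiv ℝ H u x (J y) (J z) = fderiv ℝ H u x y z := by
    have h1 : (fun p => H p (J y) (J z)) =ᶠ[𝓝 u] fun p => H p y z :=
      hherm.mono fun p hp => hp y z
    have h2 := DFunLike.congr_fun (h1.fderiv_eq (𝕜 := ℝ)) x
    rw [fderiv_apply_apply hH (d (J y)) (d (J z)), fderiv_apply_apply hH (d y) (d z)] at h2
    simpa using h2
  have e3 (x y z : E) : fderiv ℝ H u x (J y) z = -fderiv ℝ H u x y (J z) := by
    have := e2 x y (J z)
    rw [hJ, map_neg] at this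
    linarith
  have s := fderiv_metric_symm hH hsymm
  refine eq_of_forall_apply_eq hpos fun z => ?_
  have h0 : H u (J (christoffel H u v w)) z = -H u (christoffel H u v w) (J z) := by
    have := hherm.self_of_nhds (christoffel H u v w) (J z)
    rw [hJ, map_neg] at this
    linarith
  rw [h0, christoffel_spec hpos, christoffel_spec hpos]
  -- With `J` constant there is no Nijenhuis term: the Koszul expression for twice `H(Γ(v, Jw) -
  -- JΓ(v, w), z)` is exactly `c1 - c2`.
  have c1 := hclosed w v z
  have c2 := hclosed (J w) v (J z)
  simp only [coordExtDeriv, e1, hJ, map_neg] at c1 c2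
  have a1 := e3 v w z
  have a2 := e3 v w (J z)
  have a3 := e2 (J z) w v
  have a4 := s z w (J v)
  have a5 := e3 z v w
  have a6 := s z v (J w)
  have a7 := s (J z) w v
  linarith

variable {F : Type*} [NormedAddCommGroup F] [NormedSpace ℝ F] [FiniteDimensional ℝ F]

/-- The second fundamental form of a map in coordinates. -/
def coordHessian (G : E → E →L[ℝ] E →L[ℝ] ℝ) (H : F → F →L[ℝ] F →L[ℝ] ℝ) (f : E → F) (u v w : E) :
    F :=
  fderiv ℝ (fderiv ℝ f) u v w - fderiv ℝ f u (christoffel G u v w) +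
      christoffel H (f u) (fderiv ℝ f u v) (fderiv ℝ f u w)

/-- The whole argument at one point, in coordinates. In `hker` the target Christoffel term is
absent, since it vanishes once `df` kills `ker A`. -/
theorem metricTrace_coordHessian_eq_zero {G : E → E →L[ℝ] E →L[ℝ] ℝ} {A : E → E →L[ℝ] E} {u : E}
    (hG : DifferentiableAt ℝ G u)
    (hpos : ∀ v, v ≠ 0 → 0 < G u v v) (hsymm : ∀ᶠ y in 𝓝 u, ∀ v w, G y v w = G y w v)
    (hA : DifferentiableAt ℝ A u) (hskew : ∀ᶠ y in 𝓝 u, ∀ v w, G y (A y v) w = -G y v (A y w))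
    (hcube : ∀ᶠ y in 𝓝 u, ∀ v, A y (A y (A y v)) = -A y v)
    {β : E → E →L[ℝ] E →L[ℝ] ℝ}
    (hβ : ∀ᶠ y in 𝓝 u, ∀ v w, β y v w = G y v (A y w)) (hβd : DifferentiableAt ℝ β u)
    (hform : ∀ x y z, A u (A u x) = -x → A u (A u y) = -y → A u (A u z) = -z →
      coordExtDeriv β u x y z - coordExtDeriv β u (A u x) (A u y) z +
      coordExtDeriv β u (A u x) y (A u z) + coordExtDeriv β u x (A u y) (A u z) = 0)
    {f : E → F} (hf : ContDiffAt ℝ 2 f u)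
    {H : F → F →L[ℝ] F →L[ℝ] ℝ} (hH : DifferentiableAt ℝ H (f u))
    (hHpos : ∀ v, v ≠ 0 → 0 < H (f u) v v)
    (hHsymm : ∀ᶠ y in 𝓝 (f u), ∀ v w, H y v w = H y w v)
    (J : F →L[ℝ] F) (hJ : ∀ v, J (J v) = -v)
    (hherm : ∀ᶠ y in 𝓝 (f u), ∀ v w, H y (J v) (J w) = H y v w) {γ : F → F →L[ℝ] F →L[ℝ] ℝ}
    (hγ : ∀ᶠ y in 𝓝 (f u), ∀ v w, γ y v w = H y v (J w)) (hγd : DifferentiableAt ℝ γ (f u))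
    (hclosed : ∀ x y z, coordExtDeriv γ (f u) x y z = 0)
    (hfA : ∀ᶠ y in 𝓝 u, ∀ v, fderiv ℝ f y (A y v) = J (fderiv ℝ f y v))
    (hker : ∀ v w, A u v = 0 → A u w = 0 →
      fderiv ℝ (fderiv ℝ f) u v w - fderiv ℝ f u (christoffel G u v w) = 0) :
    metricTrace (G u) (coordHessian G H f u) = 0 := by
  have cs := christoffel_symm hG hpos hsymm
  have cHs := christoffel_symm hH hHpos hHsymm
  have fs : ∀ v w, fderiv ℝ (fderiv ℝ f) u v w = fderiv ℝ (fderiv ℝ f) u w v :=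
    fun v w => hf.isSymmSndFDerivAt (by simp) v w
  have hfd : DifferentiableAt ℝ (fderiv ℝ f) u :=
    (hf.fderiv_right (m := 1) (by norm_num)).differentiableAt (by norm_num)
  have hJinj : ∀ v, J v = 0 → v = 0 := fun v hv => by
    have := hJ v
    rw [hv, map_zero] at this
    simpa using this.symm
  have hA0 := hfA.self_of_nhds
  have hs0 := hskew.self_of_nhds
  have hc0 := hcube.self_of_nhds
  have Bsymm : ∀ v w, coordHessian G H f u v w = coordHessian G H f u w v := fun v w => by
    simp only [coordHessian, fs v w, cs v w, cHs (fderiv ℝ f u v)]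
  have Badd : ∀ v w w', coordHessian G H f u v (w + w') =
      coordHessian G H f u v w + coordHessian G H f u v w' := fun v w w' => by
    simp only [coordHessian, map_add]
    abel
  have Bsmul : ∀ (c : ℝ) (v w : E), coordHessian G H f u v (c • w) =
      c • coordHessian G H f u v w := fun c v w => by
    simp only [coordHessian, map_smul, smul_add, smul_sub]
  -- The covariant derivative of `df ∘ A = J ∘ df`, with `∇J = 0` entering as `h3`.
  have BA : ∀ x y, coordHessian G H f u x (A u y) =
      J (coordHessian G H f u x y) - fderiv ℝ f u (covDerivEnd G A u x y) := by
    intro x y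
    have h1 : (fun p => fderiv ℝ f p (A p y)) =ᶠ[𝓝 u] fun p => J (fderiv ℝ f p y) :=
      hfA.mono fun p hp => hp y
    have h2 := DFunLike.congr_fun (h1.fderiv_eq (𝕜 := ℝ)) x
    have dy := differentiableAt_const (𝕜 := ℝ) (x := u) y
    rw [fderiv_apply hfd (hA.clm_apply dy), fderiv_apply hA dy,
      fderiv_apply (G := fun _ => J) (differentiableAt_const J) (hfd.clm_apply dy),
      fderiv_apply hfd dy] at h2
    simp only [fderiv_fun_const, Pi.zero_apply, zero_apply, map_zero, add_zero, zero_add] at h2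
    have h3 := christoffel_map_of_closed hH hHpos hHsymm J hJ hherm hγ hγd hclosed
      (fderiv ℝ f u x) (fderiv ℝ f u y)
    simp only [coordHessian, covDerivEnd, map_add, map_sub, ← h2, hA0, h3]
    abel
  refine metricTrace_eq_zero hpos hsymm.self_of_nhds
    (LinearMap.mk₂ ℝ (coordHessian G H f u)
      (fun v v' w => by rw [Bsymm, Badd, Bsymm w, Bsymm w])
      (fun c v w => by rw [Bsymm, Bsmul, Bsymm w]) Badd Bsmul) (A u) hs0 hc0 ?_ ?_
  · intro v w hv hw
    have h1 : fderiv ℝ f u w = 0 := hJinj _ (by rw [← hA0, hw, map_zero])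
    simp [coordHessian, hker v w hv hw, h1]
  · intro x y hx hy
    simp only [LinearMap.mk₂_apply]
    have hz : ∀ x y, A u (A u x) = -x → A u (A u y) = -y →
        coordHessian G H f u x y + coordHessian G H f u (A u x) (A u y) =
        J (coordHessian G H f u (A u x) y - coordHessian G H f u x (A u y)) := by
      intro x y hx hy
      have hD : fderiv ℝ f u (covDerivEnd G A u (A u x) y +
          covDerivEnd G A u (A u (A u x)) (A u y)) = 0 := by
        have h1 : ∀ w, A u (A u w) = -w → G u w (covDerivEnd G A u (A u x) y +
          covDerivEnd G A u (A u (A u x)) (A u y)) = 0 := fun w hw =>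
          apply_covDerivEnd_add_eq_zero hG hpos hsymm hA hskew hcube hβ hβd hform
            (by rw [hx, map_neg]) hy hw
        set t := covDerivEnd G A u (A u x) y + covDerivEnd G A u (A u (A u x)) (A u y)
        -- `t` is orthogonal to `range A`. Since `A⁴ = -A²`, the squared norm of `A² t` is `-G(A² t,
        -- t) = 0`, and then `J² (df t) = df (A² t) = 0`.
        have h2 := h1 (A u (A u t)) (hc0 (A u t))
        have h3 : A u (A u t) = 0 := by
          by_contra hne
          have h4 := hpos _ hne
          have h5 : G u (A u (A u t)) (A u (A u t)) = -G u (A u (A u t)) t := by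
            rw [← neg_eq_iff_eq_neg.2 (hs0 (A u (A u t)) (A u t)),
              ← neg_eq_iff_eq_neg.2 (hs0 _ t), hc0]
            simp
          rw [h5, h2] at h4
          simp at h4
        exact hJinj _ (hJinj _ (by rw [← hA0, ← hA0, h3, map_zero]))
      have hn : covDerivEnd G A u (A u (A u x)) (A u y) = -covDerivEnd G A u x (A u y) := by
        rw [hx]
        simp only [covDerivEnd, cs (-x), cs x, map_neg, neg_apply]
        abel
      rw [hn, map_add, map_neg] at hD
      have e1 := BA (A u x) y
      have e2 := BA x (A u y)
      have e3 : coordHessian G H f u x (A u (A u y)) = -coordHessian G H f u x y := by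
        have := Bsmul (-1) x y
        rw [neg_one_smul, neg_one_smul] at this
        rw [hy, this]
      rw [e3] at e2
      rw [neg_eq_iff_eq_neg.1 e2, e1, map_sub]
      rw [← sub_eq_zero, ← neg_eq_zero, ← hD]
      abel
    -- Exchanging `x` and `y` fixes the left side of `hz` and changes the sign of the right side.
    have h1 := hz x y hx hy
    have h2 := hz y x hy hx
    rw [Bsymm y x, Bsymm (A u y) (A u x), Bsymm (A u y) x, Bsymm y (A u x), ← neg_sub, map_neg,
      ← h1] at h2
    have h3 := add_eq_zero_iff_eq_neg.2 h2
    rw [← two_smul ℝ] at h3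
    exact (smul_eq_zero.1 h3).resolve_left two_ne_zero

end CoordinateTension

theorem differentiableAt_clm_of_apply {D E X : Type*} [NormedAddCommGroup D] [NormedSpace ℝ D]
    [NormedAddCommGroup E] [NormedSpace ℝ E] [FiniteDimensional ℝ E] [NormedAddCommGroup X]
    [NormedSpace ℝ X] {f : D → E →L[ℝ] X} {x : D}
    (h : ∀ e, DifferentiableAt ℝ (fun y => f y e) x) : DifferentiableAt ℝ f x := by
  have hd : Module.finrank ℝ E = Module.finrank ℝ (Fin (Module.finrank ℝ E) → ℝ) :=
    (Module.finrank_fin_fun ℝ).symm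
  let e₁ := ContinuousLinearEquiv.ofFinrankEq hd
  let e₂ := (e₁.arrowCongr (1 : X ≃L[ℝ] X)).trans
    (ContinuousLinearEquiv.piRing (Fin (Module.finrank ℝ E)))
  rw [← Function.id_comp f, ← e₂.symm_comp_self]
  exact e₂.symm.differentiableAt.comp x (differentiableAt_pi.2 fun i => h _)

/-! ### Metrics and f-structures read in charts -/

section Charts

variable {E : Type*} [NormedAddCommGroup E] [NormedSpace ℝ E]
  {M : Type*} [TopologicalSpace M] [ChartedSpace E M]

/-- The differential of the chart at `p`. -/
def dChart (p x : M) : TangentSpace 𝓘(ℝ, E) x →L[ℝ] E :=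
  mfderiv 𝓘(ℝ, E) 𝓘(ℝ, E) (extChartAt 𝓘(ℝ, E) p) x

/-- Coordinate expression, in the chart at `p`, of a field of endomorphisms. -/
def endInChart (p : M)
    (A : Π x : M, TangentSpace 𝓘(ℝ, E) x →L[ℝ] TangentSpace 𝓘(ℝ, E) x) (u : E) : E →L[ℝ] E :=
  dChart p ((extChartAt 𝓘(ℝ, E) p).symm u) ∘L
    (A ((extChartAt 𝓘(ℝ, E) p).symm u) ∘L dParam p u)

theorem bilinInChart_apply (p : M)
    (B : Π x : M, TangentSpace 𝓘(ℝ, E) x →L[ℝ] TangentSpace 𝓘(ℝ, E) x →L[ℝ] ℝ) (u v w : E) :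
    bilinInChart p B u v w =
      B ((extChartAt 𝓘(ℝ, E) p).symm u) (dParam p u v) (dParam p u w) := rfl

theorem endInChart_apply (p : M)
    (A : Π x : M, TangentSpace 𝓘(ℝ, E) x →L[ℝ] TangentSpace 𝓘(ℝ, E) x) (u v : E) :
    endInChart p A u v = dChart p ((extChartAt 𝓘(ℝ, E) p).symm u)
      (A ((extChartAt 𝓘(ℝ, E) p).symm u) (dParam p u v)) := rfl

variable [IsManifold 𝓘(ℝ, E) ∞ M]

variable (E M) in
theorem isManifold_one : IsManifold 𝓘(ℝ, E) 1 M :=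
  IsManifold.of_le (n := ∞) (by norm_num)

theorem dChart_dParam (p : M) {u : E} (hu : u ∈ (extChartAt 𝓘(ℝ, E) p).target) (v : E) :
    dChart p ((extChartAt 𝓘(ℝ, E) p).symm u) (dParam p u v) = v := by
  have := isManifold_one E M
  have h := mfderiv_extChartAt_comp_mfderivWithin_extChartAt_symm (I := 𝓘(ℝ, E)) (x := p) hu
  simp only [modelWithCornersSelf_coe, range_id, mfderivWithin_univ] at h
  exact DFunLike.congr_fun h v

theorem dParam_dChart (p : M) {u : E} (hu : u ∈ (extChartAt 𝓘(ℝ, E) p).target)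
    (v : TangentSpace 𝓘(ℝ, E) ((extChartAt 𝓘(ℝ, E) p).symm u)) :
    dParam p u (dChart p ((extChartAt 𝓘(ℝ, E) p).symm u) v) = v := by
  have := isManifold_one E M
  have h := mfderivWithin_extChartAt_symm_comp_mfderiv_extChartAt (I := 𝓘(ℝ, E)) (x := p) hu
  simp only [modelWithCornersSelf_coe, range_id, mfderivWithin_univ] at h
  exact DFunLike.congr_fun h v

/-- Tangent vectors at `p` already are coordinates in the preferred chart at `p`. -/
theorem dChart_self (p : M) (v : TangentSpace 𝓘(ℝ, E) p) : dChart p p v = v := by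
  have := isManifold_one E M
  exact DFunLike.congr_fun (mfderiv_extChartAt_self (I := 𝓘(ℝ, E)) (x := p)) v

theorem endInChart_dChart
    (A : Π x : M, TangentSpace 𝓘(ℝ, E) x →L[ℝ] TangentSpace 𝓘(ℝ, E) x) (p : M) {x : M}
    (hx : x ∈ (extChartAt 𝓘(ℝ, E) p).source) (v : TangentSpace 𝓘(ℝ, E) x) :
    endInChart p A (extChartAt 𝓘(ℝ, E) p x) (dChart p x v) = dChart p x (A x v) := by
  obtain ⟨u, hu, rfl⟩ : ∃ u ∈ (extChartAt 𝓘(ℝ, E) p).target,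
      (extChartAt 𝓘(ℝ, E) p).symm u = x :=
    ⟨_, (extChartAt 𝓘(ℝ, E) p).map_source hx, (extChartAt 𝓘(ℝ, E) p).left_inv hx⟩
  rw [(extChartAt 𝓘(ℝ, E) p).right_inv hu, endInChart_apply, dParam_dChart p hu]

theorem endInChart_self
    (A : Π x : M, TangentSpace 𝓘(ℝ, E) x →L[ℝ] TangentSpace 𝓘(ℝ, E) x) (p : M)
    (v : TangentSpace 𝓘(ℝ, E) p) :
    endInChart p A (extChartAt 𝓘(ℝ, E) p p) v = A p v := by
  have h := endInChart_dChart A p (mem_extChartAt_source p) v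
  rwa [dChart_self, dChart_self] at h

theorem bilinInChart_fundamentalForm
    (g : ContMDiffRiemannianMetric 𝓘(ℝ, E) ∞ E (fun x : M => TangentSpace 𝓘(ℝ, E) x))
    (A : Π x : M, TangentSpace 𝓘(ℝ, E) x →L[ℝ] TangentSpace 𝓘(ℝ, E) x) (p : M) {u : E}
    (hu : u ∈ (extChartAt 𝓘(ℝ, E) p).target) (v w : E) :
    bilinInChart p (fundamentalForm g A) u v w =
      bilinInChart p g.inner u v (endInChart p A u w) := by
  rw [bilinInChart_apply, bilinInChart_apply, endInChart_apply, dParam_dChart p hu]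
  rfl

theorem bilinInChart_symm
    (g : ContMDiffRiemannianMetric 𝓘(ℝ, E) ∞ E (fun x : M => TangentSpace 𝓘(ℝ, E) x)) (p : M)
    (u v w : E) : bilinInChart p g.inner u v w = bilinInChart p g.inner u w v :=
  g.symm _ _ _

theorem bilinInChart_pos
    (g : ContMDiffRiemannianMetric 𝓘(ℝ, E) ∞ E (fun x : M => TangentSpace 𝓘(ℝ, E) x)) (p : M)
    {u : E} (hu : u ∈ (extChartAt 𝓘(ℝ, E) p).target) (v : E) (hv : v ≠ 0) :
    0 < bilinInChart p g.inner u v v := by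
  refine g.pos _ _ fun h0 => hv ?_
  rw [← dChart_dParam p hu v]
  exact (congrArg (dChart p _) h0).trans (map_zero _)

variable [FiniteDimensional ℝ E]

theorem differentiableAt_bilinInChart
    (g : ContMDiffRiemannianMetric 𝓘(ℝ, E) ∞ E (fun x : M => TangentSpace 𝓘(ℝ, E) x)) (p : M) :
    DifferentiableAt ℝ (bilinInChart p g.inner) (extChartAt 𝓘(ℝ, E) p p) := by
  have := isManifold_one E M
  -- Smoothness of `g` is tested on fields constant in the bundle trivialization; these are the
  -- coordinate fields `dParam p u e`.
  have hV : ∀ e : E, ContMDiffAt 𝓘(ℝ, E) (𝓘(ℝ, E).prod 𝓘(ℝ, E)) ∞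
      (fun x : M => TotalSpace.mk' E (E := fun x : M => TangentSpace 𝓘(ℝ, E) x) x
        ((trivializationAt E (fun x : M => TangentSpace 𝓘(ℝ, E) x) p).symmL ℝ x e)) p := by
    intro e
    rw [contMDiffAt_section]
    refine (contMDiffAt_const (c := e)).congr_of_eventuallyEq ?_
    filter_upwards [(trivializationAt E (fun x : M => TangentSpace 𝓘(ℝ, E) x)
      p).open_baseSet.mem_nhds (mem_baseSet_trivializationAt E _ p)] with x hx
    rw [Trivialization.symmL_apply]
    · exact congrArg Prod.snd (Trivialization.apply_mk_symm _ hx e)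
    · exact hx
  have hg : ∀ e e' : E, ContMDiffAt 𝓘(ℝ, E) 𝓘(ℝ, ℝ) ∞ (fun x : M =>
      g.inner x ((trivializationAt E (fun x : M => TangentSpace 𝓘(ℝ, E) x) p).symmL ℝ x e)
        ((trivializationAt E (fun x : M => TangentSpace 𝓘(ℝ, E) x) p).symmL ℝ x e')) p := by
    intro e e'
    have h := ContMDiffAt.clm_bundle_apply₂ (F₁ := E) (F₂ := E) (F₃ := ℝ)
      (E₃ := Bundle.Trivial M ℝ) (g.contMDiff p) (hV e) (hV e')
    simpa using (contMDiffAt_section p).1 h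
  have hsymm : ContMDiffAt 𝓘(ℝ, E) 𝓘(ℝ, E) ∞ (extChartAt 𝓘(ℝ, E) p).symm
      (extChartAt 𝓘(ℝ, E) p p) :=
    (contMDiffOn_extChartAt_symm p).contMDiffAt (extChartAt_target_mem_nhds p)
  have hG : ∀ e e' : E, DifferentiableAt ℝ (fun u => bilinInChart p g.inner u e e')
      (extChartAt 𝓘(ℝ, E) p p) := by
    intro e e'
    have h2 := ((hg e e').comp_of_eq hsymm (extChartAt_to_inv p)).contDiffAt.differentiableAt
      (by simp)
    refine h2.congr_of_eventuallyEq ?_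
    filter_upwards [extChartAt_target_mem_nhds p] with u hu
    have hs : (extChartAt 𝓘(ℝ, E) p).symm u ∈ (chartAt E p).source := by
      rw [← extChartAt_source 𝓘(ℝ, E)]
      exact (extChartAt 𝓘(ℝ, E) p).map_target hu
    have h3 := TangentBundle.symmL_trivializationAt (I := 𝓘(ℝ, E)) hs
    rw [(extChartAt 𝓘(ℝ, E) p).right_inv hu] at h3
    simp only [modelWithCornersSelf_coe, range_id, mfderivWithin_univ] at h3
    simp only [Function.comp_apply]
    rw [h3]
    rfl
  exact differentiableAt_clm_of_apply fun e => differentiableAt_clm_of_apply (hG e)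

/-- In adapted coordinates `A` has a constant matrix `A₀`. In the chart at `p` it is therefore `A₀`
conjugated by the derivative of a smooth transition map. -/
theorem differentiableAt_endInChart
    {A : Π x : M, TangentSpace 𝓘(ℝ, E) x →L[ℝ] TangentSpace 𝓘(ℝ, E) x} (hA : IsIntegrable A)
    (p : M) : DifferentiableAt ℝ (endInChart p A) (extChartAt 𝓘(ℝ, E) p p) := by
  have := isManifold_one E M
  obtain ⟨c, hc, hpc, k, l, b, hb⟩ := hA p
  obtain ⟨A₀, hA₀⟩ : ∃ A₀ : E →L[ℝ] E, ∀ w ∈ c.target, ∀ e,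
      A (c.symm w) (mfderiv 𝓘(ℝ, E) 𝓘(ℝ, E) c.symm w e) =
        mfderiv 𝓘(ℝ, E) 𝓘(ℝ, E) c.symm w (A₀ e) := by
    refine ⟨LinearMap.toContinuousLinearMap (b.constr ℝ (Sum.elim (fun i => b (.inr (.inl i)))
      (Sum.elim (fun i => -b (.inl i)) 0))), fun w hw e => ?_⟩
    obtain ⟨h1, h2, h3⟩ := hb w hw
    let L : E →ₗ[ℝ] TangentSpace 𝓘(ℝ, E) (c.symm w) :=
      (mfderiv 𝓘(ℝ, E) 𝓘(ℝ, E) c.symm w).toLinearMap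
    suffices h : (A (c.symm w)).toLinearMap ∘ₗ L = L ∘ₗ (b.constr ℝ
        (Sum.elim (fun i => b (.inr (.inl i))) (Sum.elim (fun i => -b (.inl i)) 0))) from
      LinearMap.congr_fun h e
    refine b.ext fun i => ?_
    simp only [LinearMap.comp_apply, Module.Basis.constr_basis]
    rcases i with i | i | i
    · exact h1 i
    · exact (h2 i).trans (map_neg _ _).symm
    · exact (h3 i).trans (map_zero _).symm
  set e := extChartAt 𝓘(ℝ, E) p with he
  set u₀ := e p with hu₀
  have hsymm : ContMDiffAt 𝓘(ℝ, E) 𝓘(ℝ, E) ∞ e.symm u₀ :=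
    (contMDiffOn_extChartAt_symm p).contMDiffAt (extChartAt_target_mem_nhds p)
  have hinv : e.symm u₀ = p := extChartAt_to_inv p
  have hψ : ContDiffAt ℝ ∞ (c ∘ e.symm) u₀ :=
    ((contMDiffAt_of_mem_maximalAtlas hc hpc).comp_of_eq hsymm hinv).contDiffAt
  have hcsymm : ContMDiffAt 𝓘(ℝ, E) 𝓘(ℝ, E) ∞ c.symm (c p) :=
    contMDiffAt_symm_of_mem_maximalAtlas hc (c.map_source hpc)
  have hχ : ContDiffAt ℝ ∞ (e ∘ c.symm) (c p) :=
    (contMDiffAt_extChartAt.comp_of_eq hcsymm (c.left_inv hpc)).contDiffAt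
  have hψp : (c ∘ e.symm) u₀ = c p := congrArg c hinv
  have h1 : DifferentiableAt ℝ (fderiv ℝ (c ∘ e.symm)) u₀ :=
    (hψ.fderiv_right (m := ∞) le_rfl).differentiableAt (by simp)
  have h2 : DifferentiableAt ℝ (fun u => fderiv ℝ (e ∘ c.symm) ((c ∘ e.symm) u)) u₀ := by
    refine DifferentiableAt.comp u₀ ?_ (hψ.differentiableAt (by simp))
    rw [hψp]
    exact (hχ.fderiv_right (m := ∞) le_rfl).differentiableAt (by simp)
  have h3 : DifferentiableAt ℝ (fun u => fderiv ℝ (e ∘ c.symm) ((c ∘ e.symm) u) ∘L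
      (A₀ ∘L fderiv ℝ (c ∘ e.symm) u)) u₀ :=
    h2.clm_comp ((differentiableAt_const A₀).clm_comp h1)
  refine h3.congr_of_eventuallyEq ?_
  have hev : ∀ᶠ u in 𝓝 u₀, u ∈ e.target ∧ e.symm u ∈ c.source :=
    Filter.Eventually.and (extChartAt_target_mem_nhds p) (hsymm.continuousAt.eventually_mem
      (c.open_source.mem_nhds (by rwa [hinv])))
  filter_upwards [hev] with u ⟨hu, huc⟩
  have hxs : e.symm u ∈ e.source := e.map_target hu
  have hxs' : e.symm u ∈ (chartAt E p).source := by rwa [← extChartAt_source 𝓘(ℝ, E)]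
  set w := c (e.symm u) with hw
  have hwt : w ∈ c.target := c.map_source huc
  have hwx : c.symm w = e.symm u := c.left_inv huc
  have dc : MDifferentiableAt 𝓘(ℝ, E) 𝓘(ℝ, E) c.symm w :=
    (contMDiffAt_symm_of_mem_maximalAtlas hc hwt).mdifferentiableAt (by simp)
  have de : MDifferentiableAt 𝓘(ℝ, E) 𝓘(ℝ, E) e (c.symm w) := by
    rw [hwx]
    exact mdifferentiableAt_extChartAt hxs'
  have hDχ : ∀ v, fderiv ℝ (e ∘ c.symm) w v =
      dChart p (c.symm w) (mfderiv 𝓘(ℝ, E) 𝓘(ℝ, E) c.symm w v) := fun v => by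
    rw [← mfderiv_eq_fderiv, mfderiv_comp w de dc]
    rfl
  have hconj : ∀ v, endInChart p A u (fderiv ℝ (e ∘ c.symm) w v) =
      fderiv ℝ (e ∘ c.symm) w (A₀ v) := fun v => by
    have h6 := (endInChart_dChart A p (x := c.symm w) (by rwa [hwx])
      (mfderiv 𝓘(ℝ, E) 𝓘(ℝ, E) c.symm w v)).trans
      (congrArg (dChart p (c.symm w)) (hA₀ w hwt v))
    have h7 : extChartAt 𝓘(ℝ, E) p (c.symm w) = u := by rw [hwx, e.right_inv hu]
    rw [h7] at h6
    rw [hDχ, hDχ]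
    exact h6
  have hid : ∀ v, fderiv ℝ (e ∘ c.symm) w (fderiv ℝ (c ∘ e.symm) u v) = v := fun v => by
    have hψu : DifferentiableAt ℝ (c ∘ e.symm) u :=
      ((contMDiffAt_of_mem_maximalAtlas hc huc).comp u
        ((contMDiffOn_extChartAt_symm (n := ∞) p).contMDiffAt
          ((isOpen_extChartAt_target p).mem_nhds hu))).contDiffAt.differentiableAt (by simp)
    have hχw : DifferentiableAt ℝ (e ∘ c.symm) ((c ∘ e.symm) u) :=
      (de.comp w dc).differentiableAt
    have h4 := fderiv_comp u hχw hψu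
    have h5 : ((e ∘ c.symm) ∘ (c ∘ e.symm)) =ᶠ[𝓝 u] id := by
      filter_upwards [(isOpen_extChartAt_target p).mem_nhds hu,
        ((contMDiffOn_extChartAt_symm (n := ∞) p).contMDiffAt
          ((isOpen_extChartAt_target p).mem_nhds hu)).continuousAt.eventually_mem
          (c.open_source.mem_nhds huc)] with y hy hyc
      simp only [Function.comp_apply, id]
      rw [c.left_inv hyc, e.right_inv hy]
    rw [h5.fderiv_eq, fderiv_id] at h4
    exact (DFunLike.congr_fun h4 v).symm
  ext v
  conv_lhs => rw [← hid v]
  exact hconj _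

end Charts

/-! ### Holomorphic charts -/

section ComplexCharts

variable {F : Type*} [NormedAddCommGroup F] [NormedSpace ℂ F]
  {N : Type*} [TopologicalSpace N] [ChartedSpace F N] [IsManifold 𝓘(ℂ, F) ω N]

/-- `J` at `y` is multiplication by `i` in the preferred chart at `y`, and charts are holomorphic.
Hence `J` is constant throughout the chart at `q`. -/
theorem dChart_complexStructure (q : N) {y : N} (hy : y ∈ (chartAt F q).source)
    (v : TangentSpace 𝓘(ℝ, F) y) :
    dChart q y (complexStructure y v) = Complex.I • dChart q y v := by
  have : IsManifold 𝓘(ℂ, F) 1 N := IsManifold.of_le (n := ω) (by norm_num)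
  have h : MDifferentiableAt 𝓘(ℂ, F) 𝓘(ℂ, F) (extChartAt 𝓘(ℂ, F) q) y :=
    mdifferentiableAt_extChartAt hy
  obtain ⟨L, hc, hL⟩ : ∃ L : F →L[ℂ] F, HasMFDerivAt 𝓘(ℂ, F) 𝓘(ℂ, F) (extChartAt 𝓘(ℂ, F) q) y L :=
    ⟨_, h.hasMFDerivAt⟩
  have h2 : HasMFDerivAt 𝓘(ℝ, F) 𝓘(ℝ, F) (extChartAt 𝓘(ℝ, F) q) y (L.restrictScalars ℝ) :=
    ⟨hc, hL.restrictScalars ℝ⟩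
  unfold dChart
  rw [h2.mfderiv]
  exact L.map_smul Complex.I v

theorem endInChart_complexStructure (q : N) {u : F} (hu : u ∈ (extChartAt 𝓘(ℝ, F) q).target)
    (v : F) : endInChart q complexStructure u v = Complex.I • v := by
  rw [endInChart_apply, dChart_complexStructure, dChart_dParam q hu]
  rw [← extChartAt_source 𝓘(ℝ, F)]
  exact (extChartAt 𝓘(ℝ, F) q).map_target hu

theorem bilinInChart_I_smul
    {h : ContMDiffRiemannianMetric 𝓘(ℝ, F) ∞ F (fun y : N => TangentSpace 𝓘(ℝ, F) y)}
    (hh : IsHermitian h) (q : N) {u : F} (hu : u ∈ (extChartAt 𝓘(ℝ, F) q).target) (v w : F) :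
    bilinInChart q h.inner u (Complex.I • v) (Complex.I • w) = bilinInChart q h.inner u v w := by
  rw [← endInChart_complexStructure q hu, ← endInChart_complexStructure q hu, bilinInChart_apply,
    endInChart_apply, endInChart_apply, dParam_dChart q hu, dParam_dChart q hu, hh]
  rfl

/-- Covectors of type (1,0) are the complex linear functionals, which separate points. -/
theorem eq_zero_of_forall_cotangentType (y : N) (x : TangentSpace 𝓘(ℝ, F) y)
    (hx : ∀ η ∈ cotangentType (E := F) (complexStructure y) 1, η x = 0) : x = 0 := by
  by_contra hne
  have hne' : (show F from x) ≠ 0 := hne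
  obtain ⟨l, hl⟩ := SeparatingDual.exists_ne_zero (R := ℂ) hne'
  refine hl (hx (l.restrictScalars ℝ) fun v => ?_)
  rw [Complex.ofReal_one, one_mul]
  exact l.map_smul Complex.I v

end ComplexCharts

/-! ### The differential of a map in charts -/

section Maps

variable {E : Type*} [NormedAddCommGroup E] [NormedSpace ℝ E]
  {M : Type*} [TopologicalSpace M] [ChartedSpace E M] [IsManifold 𝓘(ℝ, E) ∞ M]

section

variable {F : Type*} [NormedAddCommGroup F] [NormedSpace ℝ F]
  {N : Type*} [TopologicalSpace N] [ChartedSpace F N] [IsManifold 𝓘(ℝ, F) ∞ N]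

theorem fderiv_writtenInExtChartAt {φ : M → N} (hφ : ContMDiff 𝓘(ℝ, E) 𝓘(ℝ, F) ∞ φ) (p : M) {u : E}
    (hu : u ∈ (extChartAt 𝓘(ℝ, E) p).target)
    (hφu : φ ((extChartAt 𝓘(ℝ, E) p).symm u) ∈ (chartAt F (φ p)).source) (v : E) :
    fderiv ℝ (writtenInExtChartAt 𝓘(ℝ, E) 𝓘(ℝ, F) p φ) u v =
      dChart (φ p) (φ ((extChartAt 𝓘(ℝ, E) p).symm u))
        (mfderiv 𝓘(ℝ, E) 𝓘(ℝ, F) φ ((extChartAt 𝓘(ℝ, E) p).symm u) (dParam p u v)) := by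
  have := isManifold_one F N
  have h1 : MDifferentiableAt 𝓘(ℝ, E) 𝓘(ℝ, E) (extChartAt 𝓘(ℝ, E) p).symm u :=
    ((contMDiffOn_extChartAt_symm (n := ∞) p).contMDiffAt
      ((isOpen_extChartAt_target p).mem_nhds hu)).mdifferentiableAt (by simp)
  have h2 : MDifferentiableAt 𝓘(ℝ, E) 𝓘(ℝ, F) φ ((extChartAt 𝓘(ℝ, E) p).symm u) :=
    hφ.mdifferentiableAt (by simp)
  have h3 : MDifferentiableAt 𝓘(ℝ, F) 𝓘(ℝ, F) (extChartAt 𝓘(ℝ, F) (φ p))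
      (φ ((extChartAt 𝓘(ℝ, E) p).symm u)) := mdifferentiableAt_extChartAt hφu
  unfold writtenInExtChartAt
  rw [← mfderiv_eq_fderiv, mfderiv_comp u h3 (h2.comp u h1), mfderiv_comp u h2 h1]
  rfl

theorem contDiffOn_writtenInExtChartAt {φ : M → N} (hφ : ContMDiff 𝓘(ℝ, E) 𝓘(ℝ, F) ∞ φ) (p : M) :
    ContDiffOn ℝ ∞ (writtenInExtChartAt 𝓘(ℝ, E) 𝓘(ℝ, F) p φ)
      ((extChartAt 𝓘(ℝ, E) p).target ∩
        (extChartAt 𝓘(ℝ, E) p).symm ⁻¹' (φ ⁻¹' (chartAt F (φ p)).source)) := by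
  rw [← contMDiffOn_iff_contDiffOn]
  refine (contMDiffOn_extChartAt (x := φ p)).comp
    (hφ.comp_contMDiffOn ((contMDiffOn_extChartAt_symm p).mono inter_subset_left)) ?_
  intro u hu
  exact hu.2

end

variable {F : Type*} [NormedAddCommGroup F] [NormedSpace ℂ F]
  {N : Type*} [TopologicalSpace N] [ChartedSpace F N] [IsManifold 𝓘(ℂ, F) ω N]

/-- A map is holomorphic with respect to its associated f-structure. -/
theorem IsAssociatedAt.mfderiv_apply
    {g : ContMDiffRiemannianMetric 𝓘(ℝ, E) ∞ E (fun x : M => TangentSpace 𝓘(ℝ, E) x)}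
    {φ : M → N} {p : M} {A : TangentSpace 𝓘(ℝ, E) p →L[ℝ] TangentSpace 𝓘(ℝ, E) p}
    (hA : IsAssociatedAt F g φ p A) (v : TangentSpace 𝓘(ℝ, E) p) :
    mfderiv 𝓘(ℝ, E) 𝓘(ℝ, F) φ p (A v) =
      complexStructure (φ p) (mfderiv 𝓘(ℝ, E) 𝓘(ℝ, F) φ p v) := by
  rw [← sub_eq_zero]
  refine eq_zero_of_forall_cotangentType (φ p) _ fun η hη => ?_
  have h1 : η ∘L mfderiv 𝓘(ℝ, E) 𝓘(ℝ, F) φ p ∈ cotangentType A 1 := by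
    rw [← SetLike.mem_coe, hA.2.2]
    exact ⟨η, hη, rfl⟩
  have h2 : η (mfderiv 𝓘(ℝ, E) 𝓘(ℝ, F) φ p (A v)) = _ := h1 v
  have h3 := hη (mfderiv 𝓘(ℝ, E) 𝓘(ℝ, F) φ p v)
  rw [map_sub, h2, h3]
  exact sub_self _

end Maps

section

variable {E : Type*} [NormedAddCommGroup E] [NormedSpace ℝ E]

set_option synthInstance.maxHeartbeats 200000 in
theorem coordExtDeriv_neg (β : E → E →L[ℝ] E →L[ℝ] ℝ) (u x y z : E) :
    coordExtDeriv β u x y (-z) = -coordExtDeriv β u x y z := by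
  simp only [coordExtDeriv, map_neg, neg_apply]
  ring

set_option synthInstance.maxHeartbeats 200000 in
theorem christoffel_zero (G : E → E →L[ℝ] E →L[ℝ] ℝ) (u : E) : christoffel G u 0 = 0 := by
  have h : (1 / 2 : ℝ) •
      (fderiv ℝ G u 0 + (fderiv ℝ G u).flip 0 - ((fderiv ℝ G u).flip 0).flip) = 0 := by
    ext v w
    simp only [smul_apply, smul_eq_mul, sub_apply, add_apply, ContinuousLinearMap.flip_apply, map_zero, zero_apply]
    ring
  rw [christoffel, h, ContinuousLinearMap.comp_zero]

theorem differentiableAt_of_eventually_eq [FiniteDimensional ℝ E]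
    {G β : E → E →L[ℝ] E →L[ℝ] ℝ} {A : E → E →L[ℝ] E} {u : E}
    (hG : DifferentiableAt ℝ G u) (hA : DifferentiableAt ℝ A u)
    (hβ : ∀ᶠ y in 𝓝 u, ∀ v w, β y v w = G y v (A y w)) : DifferentiableAt ℝ β u := by
  refine differentiableAt_clm_of_apply fun v => differentiableAt_clm_of_apply fun w => ?_
  have h : DifferentiableAt ℝ (fun y => G y v (A y w)) u :=
    (hG.clm_apply (differentiableAt_const v)).clm_apply (hA.clm_apply (differentiableAt_const w))
  exact h.congr_of_eventuallyEq (hβ.mono fun y hy => hy v w)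

end

/-! ### The hypotheses on the f-structure in coordinates -/

section Conditions

variable {E : Type*} [NormedAddCommGroup E] [NormedSpace ℝ E] [FiniteDimensional ℝ E]
  {M : Type*} [TopologicalSpace M] [ChartedSpace E M] [IsManifold 𝓘(ℝ, E) ∞ M]

/-- The real part of the vanishing of the part of type `(-, -, +)` of the exterior derivative of
the fundamental form. -/
theorem FundamentalFormCondition.coord
    {g : ContMDiffRiemannianMetric 𝓘(ℝ, E) ∞ E (fun x : M => TangentSpace 𝓘(ℝ, E) x)}
    {A : Π x : M, TangentSpace 𝓘(ℝ, E) x →L[ℝ] TangentSpace 𝓘(ℝ, E) x}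
    (hform : FundamentalFormCondition g A) (p : M) (x y z : TangentSpace 𝓘(ℝ, E) p)
    (hx : A p (A p x) = -x) (hy : A p (A p y) = -y) (hz : A p (A p z) = -z) :
    extDerivTwo (fundamentalForm g A) p x y z -
      extDerivTwo (fundamentalForm g A) p (A p x) (A p y) z +
      extDerivTwo (fundamentalForm g A) p (A p x) y (A p z) +
      extDerivTwo (fundamentalForm g A) p x (A p y) (A p z) = 0 := by
  have hneg : ∀ a b c : TangentSpace 𝓘(ℝ, E) p, extDerivTwo (fundamentalForm g A) p a b (-c) =
      -extDerivTwo (fundamentalForm g A) p a b c := by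
    intro a b c
    exact coordExtDeriv_neg _ _ _ _ _
  -- For `x` in `range A`, `x + iAx` is of type `-` and `x - iAx` of type `+`.
  have h := hform p (-1) 1 (by simp) (by simp) (by norm_num) ![x, A p x] ![y, A p y] ![z, -A p z]
    (by constructor <;> simp [hx]) (by constructor <;> simp [hy]) (by constructor <;> simp [hz])
  have h2 := congrArg Complex.re h
  simp [extDerivTwoC, Fin.sum_univ_two, hneg, pow_succ] at h2
  linarith

theorem CovDerivZeroPlusCondition.coord {F : Type*} [NormedAddCommGroup F] [NormedSpace ℂ F]
    {N : Type*} [TopologicalSpace N] [ChartedSpace F N] [IsManifold 𝓘(ℂ, F) ω N]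
    {g : ContMDiffRiemannianMetric 𝓘(ℝ, E) ∞ E (fun x : M => TangentSpace 𝓘(ℝ, E) x)}
    {A : Π x : M, TangentSpace 𝓘(ℝ, E) x →L[ℝ] TangentSpace 𝓘(ℝ, E) x}
    (hcov : CovDerivZeroPlusCondition g A) {φ : M → N} (hφ : ContMDiff 𝓘(ℝ, E) 𝓘(ℝ, F) ∞ φ)
    (hA : ∀ q, IsAssociatedAt F g φ q (A q)) (p : M) (v w : TangentSpace 𝓘(ℝ, E) p)
    (hv : A p v = 0) (hw : A p w = 0) :
    fderiv ℝ (fderiv ℝ (writtenInExtChartAt 𝓘(ℝ, E) 𝓘(ℝ, F) p φ)) (extChartAt 𝓘(ℝ, E) p p) v w -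
      fderiv ℝ (writtenInExtChartAt 𝓘(ℝ, E) 𝓘(ℝ, F) p φ) (extChartAt 𝓘(ℝ, E) p p)
        (christoffel (bilinInChart p g.inner) (extChartAt 𝓘(ℝ, E) p p) v w) = 0 := by
  set f := writtenInExtChartAt 𝓘(ℝ, E) 𝓘(ℝ, F) p φ with hf
  set u := extChartAt 𝓘(ℝ, E) p p with hu
  set U : Set M := φ ⁻¹' (chartAt F (φ p)).source with hU
  have hUo : IsOpen U := (chartAt F (φ p)).open_source.preimage hφ.continuous
  have hpU : p ∈ U := mem_chart_source F (φ p)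
  set S : Set E := (extChartAt 𝓘(ℝ, E) p).target ∩ (extChartAt 𝓘(ℝ, E) p).symm ⁻¹' U with hS
  have hSo : IsOpen S := (continuousOn_extChartAt_symm p).isOpen_inter_preimage
    (isOpen_extChartAt_target p) hUo
  have huS : u ∈ S := ⟨mem_extChartAt_target p, by
    rw [mem_preimage, extChartAt_to_inv]
    exact hpU⟩
  have hfS : ContDiffOn ℝ ∞ f S := contDiffOn_writtenInExtChartAt hφ p
  have hfS' : ContDiffOn ℝ ∞ (fderiv ℝ f) S := hfS.fderiv_of_isOpen hSo le_rfl
  have hfd : DifferentiableAt ℝ (fderiv ℝ f) u :=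
    (hfS'.contDiffAt (hSo.mem_nhds huS)).differentiableAt (by simp)
  refine eq_zero_of_forall_cotangentType (F := F) (φ p) _ fun η hη => ?_
  have hηI : ∀ x : F, η (Complex.I • x) = Complex.I * η x := fun x => by
    have := hη x
    rw [Complex.ofReal_one, one_mul] at this
    exact this
  let η' : F →L[ℝ] ℂ := η
  -- The pullback of the (1,0)-form with constant coefficients `η` in the holomorphic chart at `φ
  -- p`. In coordinates it is `η ∘ Df`, so its derivative is `η ∘ D²f`.
  let θ : Π x : M, TangentSpace 𝓘(ℝ, E) x →L[ℝ] ℂ := fun q =>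
    η' ∘L (dChart (φ p) (φ q) ∘L mfderiv 𝓘(ℝ, E) 𝓘(ℝ, F) φ q)
  have hθ : ∀ y ∈ S, covectorInChart p θ y = η' ∘L fderiv ℝ f y := by
    intro y hy
    ext x
    rw [ContinuousLinearMap.comp_apply, fderiv_writtenInExtChartAt hφ p hy.1 hy.2]
    rfl
  have hθev : covectorInChart p θ =ᶠ[𝓝 u] fun y => η' ∘L fderiv ℝ f y :=
    Filter.eventuallyEq_of_mem (hSo.mem_nhds huS) hθ
  have hθS : ContDiffOn ℝ ∞ (covectorInChart p θ) S :=
    (contDiffOn_const.clm_comp hfS').congr hθ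
  have hmem := hcov p U hUo hpU θ hθS (fun q hq x => by
    rw [Complex.ofReal_one, one_mul]
    have h1 := dChart_complexStructure (φ p) hq (mfderiv 𝓘(ℝ, E) 𝓘(ℝ, F) φ q x)
    rw [← (hA q).mfderiv_apply] at h1
    exact (congrArg η' h1).trans (hηI _)) ![v, 0] (by constructor <;> simp [hv])
  -- The real vector `v` enters as the pair `![v, 0]`; its imaginary part contributes nothing.
  have hz : covDerivForm g θ p 0 w = 0 := by
    change (fderiv ℝ (covectorInChart p θ) u 0 - covectorInChart p θ u ∘L
      christoffel (bilinInChart p g.inner) u 0 : E →L[ℝ] ℂ) w = 0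
    rw [christoffel_zero, map_zero, ContinuousLinearMap.comp_zero, sub_zero]
    rfl
  have hcv : covDerivForm g θ p v w = η' (fderiv ℝ (fderiv ℝ f) u v w -
      fderiv ℝ f u (christoffel (bilinInChart p g.inner) u v w)) := by
    have h1 : fderiv ℝ (covectorInChart p θ) u v w = η' (fderiv ℝ (fderiv ℝ f) u v w) := by
      rw [hθev.fderiv_eq, fderiv_clm_comp (differentiableAt_const _) hfd]
      simp
      rfl
    rw [map_sub, ← h1, ← ContinuousLinearMap.comp_apply η' (fderiv ℝ f u), ← hθ u huS]
    rfl
  obtain ⟨a, ha, b, hb, hab⟩ := Submodule.mem_sup.1 hmem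
  -- A covector with `a ∘ A = ±i a` vanishes on `ker A`.
  have ha' := ha w
  have hb' := hb w
  rw [hw, map_zero] at ha' hb'
  have ha0 : a w = 0 := by simpa using ha'.symm
  have hb0 : b w = 0 := by simpa using hb'.symm
  have h3 : a w + b w = covDerivForm g θ p v w + Complex.I * covDerivForm g θ p 0 w :=
    DFunLike.congr_fun hab w
  rw [ha0, hb0, hz, mul_zero, add_zero, add_zero] at h3
  exact hcv.symm.trans h3.symm

end Conditions

end PHM

end

/-! ### Harmonicity -/

theorem mainTheorem5
    {E : Type*} [NormedAddCommGroup E] [NormedSpace ℝ E] [FiniteDimensional ℝ E]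
    {M : Type*} [TopologicalSpace M] [ChartedSpace E M] [IsManifold 𝓘(ℝ, E) ∞ M]
    {F : Type*} [NormedAddCommGroup F] [NormedSpace ℂ F] [FiniteDimensional ℂ F]
    {N : Type*} [TopologicalSpace N] [ChartedSpace F N] [IsManifold 𝓘(ℂ, F) ω N]
    (g : ContMDiffRiemannianMetric 𝓘(ℝ, E) ∞ E (fun x : M => TangentSpace 𝓘(ℝ, E) x))
    (h : ContMDiffRiemannianMetric 𝓘(ℝ, F) ∞ F (fun y : N => TangentSpace 𝓘(ℝ, F) y))
    (hKahler : PHM.IsKahler h)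
    (φ : M → N) (hφ : ContMDiff 𝓘(ℝ, E) 𝓘(ℝ, F) ∞ φ) (hconst : ¬ ∃ y : N, ∀ x : M, φ x = y)
    (hPHWC : PHM.IsPHWC g h φ)
    (hint : PHM.IsIntegrable (PHM.associatedFStructure F g φ))
    (hcov : PHM.CovDerivZeroPlusCondition g (PHM.associatedFStructure F g φ))
    (hform : PHM.FundamentalFormCondition g (PHM.associatedFStructure F g φ)) :
    PHM.IsHarmonic g h φ := by
  intro p
  have : FiniteDimensional ℝ F := FiniteDimensional.complexToReal F
  obtain ⟨hherm, hclosed⟩ := hKahler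
  have hA : ∀ q, PHM.IsAssociatedAt F g φ q (PHM.associatedFStructure F g φ q) :=
    PHM.associatedFStructure_spec g h hherm φ hPHWC
  set A := PHM.associatedFStructure F g φ
  set f := writtenInExtChartAt 𝓘(ℝ, E) 𝓘(ℝ, F) p φ with hf
  set u := extChartAt 𝓘(ℝ, E) p p with hu
  have hfu : f u = extChartAt 𝓘(ℝ, F) (φ p) (φ p) := by
    simp only [hf, writtenInExtChartAt, Function.comp_apply, hu, extChartAt_to_inv]
  have hut : u ∈ (extChartAt 𝓘(ℝ, E) p).target := mem_extChartAt_target p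
  have hev : ∀ᶠ y in 𝓝 u, y ∈ (extChartAt 𝓘(ℝ, E) p).target := extChartAt_target_mem_nhds p
  have hvt : f u ∈ (extChartAt 𝓘(ℝ, F) (φ p)).target := by
    rw [hfu]
    exact mem_extChartAt_target (φ p)
  have hev' : ∀ᶠ y in 𝓝 (f u), y ∈ (extChartAt 𝓘(ℝ, F) (φ p)).target :=
    (isOpen_extChartAt_target (φ p)).mem_nhds hvt
  have hφev : ∀ᶠ y in 𝓝 u, φ ((extChartAt 𝓘(ℝ, E) p).symm y) ∈ (chartAt F (φ p)).source := by
    have hc : ContinuousAt (φ ∘ (extChartAt 𝓘(ℝ, E) p).symm) u :=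
      hφ.continuous.continuousAt.comp (continuousAt_extChartAt_symm p)
    refine hc.eventually_mem ((chartAt F (φ p)).open_source.mem_nhds ?_)
    rw [Function.comp_apply, hu, extChartAt_to_inv]
    exact mem_chart_source F (φ p)
  have hG := PHM.differentiableAt_bilinInChart g p
  have hAd := PHM.differentiableAt_endInChart hint p
  have hH := PHM.differentiableAt_bilinInChart h (φ p)
  rw [← hfu] at hH
  have hAu : ∀ v, PHM.endInChart p A u v = A p v := PHM.endInChart_self A p
  have hβ : ∀ᶠ y in 𝓝 u, ∀ v w, PHM.bilinInChart p (PHM.fundamentalForm g A) y v w =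
      PHM.bilinInChart p g.inner y v (PHM.endInChart p A y w) :=
    hev.mono fun y hy => PHM.bilinInChart_fundamentalForm g A p hy
  have hγ : ∀ᶠ y in 𝓝 (f u), ∀ v w,
      PHM.bilinInChart (φ p) (PHM.fundamentalForm h PHM.complexStructure) y v w =
      PHM.bilinInChart (φ p) h.inner y v ((Complex.I • ContinuousLinearMap.id ℝ F) w) :=
    hev'.mono fun y hy v w => by
      rw [PHM.bilinInChart_fundamentalForm h _ (φ p) hy, PHM.endInChart_complexStructure _ hy]
      rfl
  have hβd := PHM.differentiableAt_of_eventually_eq hG hAd hβ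
  have hγd := PHM.differentiableAt_of_eventually_eq hH
    (differentiableAt_const (Complex.I • ContinuousLinearMap.id ℝ F)) hγ
  have hfc : ContDiffAt ℝ 2 f u :=
    ((PHM.contDiffOn_writtenInExtChartAt hφ p).contDiffAt (hev.and hφev)).of_le (by norm_cast)
  -- By definition the tension field at `p` is the metric trace of `coordHessian` in the preferred
  -- charts at `p` and `φ p`.
  refine PHM.metricTrace_coordHessian_eq_zero (A := PHM.endInChart p A)
    (β := PHM.bilinInChart p (PHM.fundamentalForm g A)) (f := f)
    (J := Complex.I • ContinuousLinearMap.id ℝ F)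
    (γ := PHM.bilinInChart (φ p) (PHM.fundamentalForm h PHM.complexStructure))
    hG (PHM.bilinInChart_pos g p hut) (.of_forall (PHM.bilinInChart_symm g p)) hAd ?_ ?_ hβ hβd ?_
    hfc hH (PHM.bilinInChart_pos h (φ p) hvt) (.of_forall (PHM.bilinInChart_symm h (φ p)))
    (fun v => ?_) (hev'.mono fun y hy => PHM.bilinInChart_I_smul hherm (φ p) hy) hγ hγd ?_ ?_ ?_
  · filter_upwards [hev] with y hy v w
    rw [PHM.bilinInChart_apply, PHM.bilinInChart_apply, PHM.endInChart_apply, PHM.endInChart_apply,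
      PHM.dParam_dChart p hy, PHM.dParam_dChart p hy]
    exact (hA _).1 _ _
  · filter_upwards [hev] with y hy v
    rw [PHM.endInChart_apply, PHM.endInChart_apply, PHM.endInChart_apply,
      PHM.dParam_dChart p hy, PHM.dParam_dChart p hy, eq_neg_of_add_eq_zero_left ((hA _).2.1 _)]
    exact map_neg _ _
  · intro x y z
    have hAu' : PHM.endInChart p A u = (show E →L[ℝ] E from A p) :=
      ContinuousLinearMap.ext hAu
    rw [hAu']
    exact hform.coord p x y z
  · change Complex.I • (Complex.I • v) = -v
    rw [smul_smul, Complex.I_mul_I, neg_one_smul]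
  · rw [hfu]
    exact hclosed (φ p)
  · filter_upwards [hev, hφev] with y hy hφy v
    rw [PHM.fderiv_writtenInExtChartAt hφ p hy hφy, PHM.fderiv_writtenInExtChartAt hφ p hy hφy,
      PHM.endInChart_apply, PHM.dParam_dChart p hy, (hA _).mfderiv_apply,
      PHM.dChart_complexStructure (φ p) hφy]
    rfl
  · intro v w
    rw [hAu, hAu]
    exact hcov.coord hφ hA p v w
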